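/- Let $d\ge 1$, let $X,X_1,X_2,\dots$ be independent identically distributed real random variables with symmetric law (that is, $X$ and $-X$ have the same distribution), and for $n\ge 1$ put $I_n=\{(i_1,\dots,i_d): 1\le i_1<i_2<\dots<i_d\le n\}$ and $$c_n=\inf\Big\{c>0:\ n\,E\Big(\frac{X^2}{c^2}\wedge 1\Big)\le 1\Big\}.$$ (The infimum is a minimum as soon as $n\,P(X\neq 0)>1$, hence for all large $n$ unless $X=0$ a.s.; otherwise $c_n=0$. If $c_n=0$, read $\gamma_n^2/c_n^{2(d-l)}$ below as $0$ when $l<d$; when $l=d$ it is $\gamma_n^2$.) Let $(\gamma_n)_{n\ge1}$ be a sequence of positive reals such that, for some constant $C$, 1. $\gamma_n$ is nondecreasing; 2. $\gamma_{2n}\le C\gamma_n$ for all $n\ge 1$; 3. $\displaystyle\sum_{k\ge l}\frac{2^{dk}}{\gamma_{2^k}^2}\le C\,\frac{2^{dl}}{\gamma_{2^l}^2}$ for all $l=1,2,\dots$ (in particular the series converges). Then the following are equivalent: (a) $\displaystyle\frac1{\gamma_n}\sum_{(i_1,\dots,i_d)\in I_n}\ \prod_{r=1}^d X_{i_r}\to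 0$ almost surely as $n\to\infty$; (b) for every $1\le l\le d$, $$\sum_{k=1}^\infty 2^{kl}\,P\Big(\prod_{r=1}^l X_r^2>\frac{\gamma_{2^k}^2}{c_{2^k}^{2(d-l)}},\ \min_{1\le r\le l}X_r^2>c_{2^k}^2\Big)<\infty .$$ -/

import Mathlib

open MeasureTheory ProbabilityTheory Filter Topology

/-- The regularity conditions on a normalizing sequence `γ₁, γ₂, …` of positive reals in
dimension `d`; the value `γ 0` is irrelevant. -/
structure RegularNormalizing (d : ℕ) (γ : ℕ → ℝ) : Prop where
  pos : ∀ n, 1 ≤ n → 0 < γ n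
  mono : ∀ m n, 1 ≤ m → m ≤ n → γ m ≤ γ n
  doubling : ∃ C : ℝ, ∀ n, 1 ≤ n → γ (2 * n) ≤ C * γ n
  series : ∃ C : ℝ, ∀ l, 1 ≤ l →
    Summable (fun j : ℕ => (2 : ℝ) ^ (d * (l + j)) / γ (2 ^ (l + j)) ^ 2) ∧
      ∑' j : ℕ, (2 : ℝ) ^ (d * (l + j)) / γ (2 ^ (l + j)) ^ 2
        ≤ C * ((2 : ℝ) ^ (d * l) / γ (2 ^ l) ^ 2)

/-- The truncation level `c_n = min {c > 0 : n E(Y² / c² ∧ 1) ≤ 1}`. The infimum is a minimum as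
soon as it is positive, that is, as soon as `n P(Y ≠ 0) > 1`; for the remaining `n` (finitely
many, unless `Y = 0` almost surely) the set is the whole half-line and the value is `0`. -/
noncomputable def truncLevel {Ω : Type*} [MeasurableSpace Ω] (P : Measure Ω) (Y : Ω → ℝ)
    (n : ℕ) : ℝ :=
  sInf {c : ℝ | 0 < c ∧ (n : ℝ) * ∫ ω, min (Y ω ^ 2 / c ^ 2) 1 ∂P ≤ 1}

/-- The strictly increasing multi-indices `i₁ < i₂ < ⋯ < i_d` in a set of `n` indices, numbered
from `0` to `n - 1`. -/
def increasingIndices (d n : ℕ) : Finset (Fin d → Fin n) :=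
  {i : Fin d → Fin n | ∀ r s : Fin d, r < s → i r < i s}

/-- The sum over all increasing multi-indices of the product kernel `x₁ x₂ ⋯ x_d`, where the
sequence is `X 0, X 1, …`. -/
def productSum {Ω : Type*} (d : ℕ) (X : ℕ → Ω → ℝ) (n : ℕ) (ω : Ω) : ℝ :=
  ∑ i ∈ increasingIndices d n, ∏ r : Fin d, X (i r) ω

/-- The event `∏_{r ≤ l} X_r² > γ_n² / c_n^{2(d-l)}` and `min_{r ≤ l} X_r² > c_n²`, for the first
`l` variables of the sequence. -/
def exceedanceEvent {Ω : Type*} [MeasurableSpace Ω] (P : Measure Ω) (X : ℕ → Ω → ℝ)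
    (γ : ℕ → ℝ) (d l n : ℕ) : Set Ω :=
  {ω | γ n ^ 2 / truncLevel P (X 0) n ^ (2 * (d - l)) < ∏ r : Fin l, X r ω ^ 2 ∧
    ∀ r : Fin l, truncLevel P (X 0) n ^ 2 < X r ω ^ 2}

/-! Write `g = c_n ^ 2` and `G = γ_n ^ 2` at `n = 2 ^ k`, and work with the law of the sequence on
`ℕ → ℝ`, where changing the signs of coordinates preserves measure.

Sufficiency. Each kernel `∏ x_i` is cut off where `∏ max (x_i ^ 2) g > G`. If `J` is the set of `i`
with `x_i ^ 2 > g`, this region is exactly the exceedance event of (b) for the variables in `J`,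
with `l = |J|`. A union bound therefore controls the probability that some kernel is cut by the
terms of (b). The truncated kernels remain odd in every coordinate, hence orthogonal, and their sums
form a martingale. Kolmogorov's inequality then leaves the series of `2 ^ (d k) / G_k * T_k` to be
summed, `T_k` being the truncated second moment (`summable_truncMoment`). Passing from level `k` to
`k + 1` increases `T` by at most `G_{k+1}` times a moment over the exceedance region. Since `2 ^ k E
min (X ^ 2 / g_k) 1 = 1`, that moment times `2 ^ (d k)` is bounded by the terms of (b). The tail
sums `R_k` of the regularity series are comparable with `2 ^ (d k) / G_k` and decay geometrically,
so `R_k T_k` satisfies a contraction with summable error. The case `J = ∅` must be excluded, that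
is, `g_k ^ d ≤ G_k` is needed for large `k`. This follows from (b) with `l = d` by a second
contraction argument (`eventually_level_pow_le`).

Necessity. Alternating the elementary symmetric polynomial over sign changes of `d` disjoint blocks
yields `2 ^ d` times the product of the block sums. The blocks can be placed after any given past,
so a large product of block sums makes a large value of the symmetric polynomial conditionally
likely. A conditional Borel–Cantelli argument gives summability of the probabilities that the
product of `d` independent copies of `S_N`, `N = 2 ^ K`, exceeds `ε γ_N` (`summable_blockProb`). For
symmetric variables `P(|S_N| > t) ≥ (N / 4) P(|X| > t)` when `t ≥ c_N`, and `P(|S_N| ≥ c_N / 3) ≥ 1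
/ 20`. Using the first bound for `l` factors and the second for the other `d - l` recovers the terms
of (b) (`pow_mul_bigProb_le`). -/

/-- The law of a family of independent real random variables with common law `μ`. -/
noncomputable abbrev iidLaw (ι : Type*) (μ : Measure ℝ) : Measure (ι → ℝ) :=
  Measure.infinitePi fun _ : ι => μ

/-- Change the signs of the coordinates in `E`. -/
def signFlip (E : Finset ℕ) (x : ℕ → ℝ) : ℕ → ℝ := fun i => if i ∈ E then -x i else x i

/-! ### Independence and symmetry on the sequence space. -/

section Foundations

variable {μ : Measure ℝ} [IsProbabilityMeasure μ]

/-- The freedom in `σ` and `T` covers passing to a subfamily, flipping signs on a set of indices,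
and reflecting large coordinates. -/
theorem measurePreserving_reindex {ι κ : Type*} {σ : κ → ι} (hσ : σ.Injective)
    {T : κ → ℝ → ℝ} (hT : ∀ k, MeasurePreserving (T k) μ μ) :
    MeasurePreserving (fun (x : ι → ℝ) k => T k (x (σ k))) (iidLaw ι μ) (iidLaw κ μ) := by
  have hm : ∀ k, Measurable (T k) := fun k => (hT k).measurable
  refine ⟨by fun_prop, ?_⟩
  have h1 : iIndepFun (fun (i : ι) (x : ι → ℝ) => x i) (iidLaw ι μ) :=
    iIndepFun_infinitePi (X := fun _ x => x) (fun _ => measurable_id)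
  have h2 := (h1.precomp hσ).comp T hm
  have h3 := h2.map_fun_eq_infinitePi_map (fun k => (hm k).comp (measurable_pi_apply _))
  have h4 : ∀ k : κ, (iidLaw ι μ).map (T k ∘ fun x => x (σ k)) = μ := fun k => by
    rw [← Measure.map_map (hm k) (measurable_pi_apply _), Measure.infinitePi_map_eval,
      (hT k).map_eq]
  simp only [h4] at h3
  exact h3

theorem measurePreserving_comp_injective {ι κ : Type*} {σ : κ → ι} (hσ : σ.Injective) :
    MeasurePreserving (fun (x : ι → ℝ) k => x (σ k)) (iidLaw ι μ) (iidLaw κ μ) :=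
  measurePreserving_reindex (T := fun _ x => x) hσ fun _ => MeasurePreserving.id μ

theorem measurePreserving_signFlip (hμ : MeasurePreserving (fun x : ℝ => -x) μ μ) (E : Finset ℕ) :
    MeasurePreserving (signFlip E) (iidLaw ℕ μ) (iidLaw ℕ μ) := by
  have := measurePreserving_reindex (μ := μ) (σ := fun i : ℕ => i) (fun _ _ h => h)
    (T := fun i => if i ∈ E then (fun x => -x) else fun x => x)
    (fun k => by split_ifs; exacts [hμ, MeasurePreserving.id μ])
  convert this using 1
  ext x i
  simp only [signFlip]
  split_ifs <;> rfl

theorem indepFun_of_dependsOn {β γ : Type*} [MeasurableSpace β] [MeasurableSpace γ]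
    {f : (ℕ → ℝ) → β} {g : (ℕ → ℝ) → γ} (hf : Measurable f) (hg : Measurable g)
    {s t : Finset ℕ} (hst : Disjoint s t) (hfs : DependsOn f (s : Set ℕ))
    (hgt : DependsOn g (t : Set ℕ)) : IndepFun f g (iidLaw ℕ μ) := by
  have h1 : iIndepFun (fun (i : ℕ) (x : ℕ → ℝ) => x i) (iidLaw ℕ μ) :=
    iIndepFun_infinitePi (X := fun _ x => x) (fun _ => measurable_id)
  have h2 := h1.indepFun_finset s t hst (fun i => measurable_pi_apply i)
  -- Extension by zero makes a function of finitely many coordinates factor through the restriction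
  -- to them.
  let ext (u : Finset ℕ) (y : u → ℝ) : ℕ → ℝ := fun i => if h : i ∈ u then y ⟨i, h⟩ else 0
  have hext : ∀ u, Measurable (ext u) := fun u => by
    refine measurable_pi_lambda _ fun i => ?_
    by_cases h : i ∈ u
    · simp only [ext, h, dite_true]; exact measurable_pi_apply _
    · simp only [ext, h, dite_false]; exact measurable_const
  have h3 := h2.comp (hf.comp (hext s)) (hg.comp (hext t))
  convert h3 using 1
  · ext1 x
    exact hfs fun i hi => by simp [ext, Finset.mem_coe.1 hi]
  · ext1 x
    exact hgt fun i hi => by simp [ext, Finset.mem_coe.1 hi]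

theorem measure_inter_of_dependsOn {A B : Set (ℕ → ℝ)} (hA : MeasurableSet A)
    (hB : MeasurableSet B) {s t : Finset ℕ} (hst : Disjoint s t)
    (hAs : DependsOn (· ∈ A) (s : Set ℕ)) (hBt : DependsOn (· ∈ B) (t : Set ℕ)) :
    iidLaw ℕ μ (A ∩ B) = iidLaw ℕ μ A * iidLaw ℕ μ B := by
  have h := indepFun_of_dependsOn (μ := μ) (f := (· ∈ A)) (g := (· ∈ B))
    (measurable_mem.2 hA) (measurable_mem.2 hB) hst hAs hBt
  have := h.measure_inter_preimage_eq_mul {True} {True} trivial trivial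
  have e : ∀ C : Set (ℕ → ℝ), (· ∈ C) ⁻¹' {True} = C := fun C => by ext; simp
  simpa only [e] using this

theorem integral_mul_of_dependsOn {f g : (ℕ → ℝ) → ℝ} (hf : Measurable f) (hg : Measurable g)
    {s t : Finset ℕ} (hst : Disjoint s t) (hfs : DependsOn f (s : Set ℕ))
    (hgt : DependsOn g (t : Set ℕ)) :
    ∫ x, f x * g x ∂(iidLaw ℕ μ) = (∫ x, f x ∂(iidLaw ℕ μ)) * ∫ x, g x ∂(iidLaw ℕ μ) :=
  (indepFun_of_dependsOn hf hg hst hfs hgt).integral_fun_mul_eq_mul_integral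
    hf.aestronglyMeasurable hg.aestronglyMeasurable

/-- Integrability is not needed: the change of variables for the Bochner integral holds in any case.
-/
theorem integral_eq_zero_of_odd {Ω : Type*} [MeasurableSpace Ω] {Q : Measure Ω} {T : Ω → Ω}
    (hT : MeasurePreserving T Q Q) {f : Ω → ℝ} (hf : Measurable f)
    (hodd : ∀ x, f (T x) = -f x) : ∫ x, f x ∂Q = 0 := by
  have h : ∫ x, f (T x) ∂Q = ∫ x, f x ∂Q := by
    rw [← integral_map hT.measurable.aemeasurable hf.aestronglyMeasurable, hT.map_eq]
  simp only [hodd, integral_neg] at h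
  linarith

theorem integrable_of_abs_le {Ω : Type*} [MeasurableSpace Ω] {Q : Measure Ω} [IsFiniteMeasure Q]
    {f : Ω → ℝ} (hf : Measurable f) {B : ℝ} (hB : ∀ x, |f x| ≤ B) : Integrable f Q :=
  Integrable.of_bound hf.aestronglyMeasurable B (Eventually.of_forall hB)

end Foundations

/-! ### Orthogonality and the maximal inequality for odd kernels. -/

section OddKernels

variable {μ : Measure ℝ} [IsProbabilityMeasure μ]

/-- Bounded measurable kernels indexed by finite sets `I`, each depending on the coordinates in `I`
only and odd in each of them. -/
structure OddKernel (ψ : Finset ℕ → (ℕ → ℝ) → ℝ) (B : ℝ) : Prop where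
  meas : ∀ I, Measurable (ψ I)
  bound : ∀ I x, |ψ I x| ≤ B
  dep : ∀ I, DependsOn (ψ I) (I : Set ℕ)
  odd : ∀ I, ∀ i ∈ I, ∀ x, ψ I (signFlip {i} x) = -ψ I x

/-- The sum of the kernels over the `d`-element subsets of `{0, …, n - 1}`. -/
def kernelSum (ψ : Finset ℕ → (ℕ → ℝ) → ℝ) (d n : ℕ) (x : ℕ → ℝ) : ℝ :=
  ∑ I ∈ (Finset.range n).powersetCard d, ψ I x

theorem DependsOn.signFlip_singleton {β : Type*} {f : (ℕ → ℝ) → β} {s : Finset ℕ}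
    (hf : DependsOn f (s : Set ℕ)) {i : ℕ} (hi : i ∉ s) (x : ℕ → ℝ) :
    f (signFlip {i} x) = f x := by
  refine hf fun j hj => ?_
  have : j ≠ i := fun h => hi (h ▸ Finset.mem_coe.1 hj)
  simp [signFlip, this]

variable {ψ : Finset ℕ → (ℕ → ℝ) → ℝ} {B : ℝ} {d : ℕ}

/-- Flipping coordinate `i` changes the sign of `ψ I` and leaves `f` alone. This is the source of
both orthogonality and the martingale property. -/
theorem OddKernel.integral_mul_eq_zero (hψ : OddKernel ψ B)
    (hμ : MeasurePreserving (fun x : ℝ => -x) μ μ) {I s : Finset ℕ} {i : ℕ} (hi : i ∈ I)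
    (his : i ∉ s) {f : (ℕ → ℝ) → ℝ} (hf : Measurable f) (hfs : DependsOn f (s : Set ℕ)) :
    ∫ x, ψ I x * f x ∂(iidLaw ℕ μ) = 0 :=
  integral_eq_zero_of_odd (measurePreserving_signFlip hμ {i}) ((hψ.meas I).mul hf) fun x => by
    rw [hψ.odd I i hi, hfs.signFlip_singleton his, neg_mul]

theorem OddKernel.measurable_kernelSum (hψ : OddKernel ψ B) (n : ℕ) :
    Measurable (kernelSum ψ d n) :=
  Finset.measurable_fun_sum _ fun I _ => hψ.meas I

theorem OddKernel.abs_kernelSum_le (hψ : OddKernel ψ B) (n : ℕ) (x : ℕ → ℝ) :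
    |kernelSum ψ d n x| ≤ ((Finset.range n).powersetCard d).card * B := by
  refine (Finset.abs_sum_le_sum_abs _ _).trans ?_
  rw [← nsmul_eq_mul]
  exact Finset.sum_le_card_nsmul _ _ _ fun I _ => hψ.bound I x

theorem OddKernel.dependsOn_kernelSum (hψ : OddKernel ψ B) (n : ℕ) :
    DependsOn (kernelSum ψ d n) (Finset.range n : Set ℕ) := by
  intro x y h
  refine Finset.sum_congr rfl fun I hI => hψ.dep I fun i hi => h i ?_
  exact Finset.mem_coe.2 ((Finset.mem_powersetCard.1 hI).1 (Finset.mem_coe.1 hi))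

/-- Of two distinct sets of the same size, each contains an index missing from the other, so mixed
products integrate to zero. -/
theorem OddKernel.integral_kernelSum_sq (hψ : OddKernel ψ B)
    (hμ : MeasurePreserving (fun x : ℝ => -x) μ μ) (n : ℕ) :
    ∫ x, kernelSum ψ d n x ^ 2 ∂(iidLaw ℕ μ) =
      ∑ I ∈ (Finset.range n).powersetCard d, ∫ x, ψ I x ^ 2 ∂(iidLaw ℕ μ) := by
  have hint : ∀ I J, Integrable (fun x => ψ I x * ψ J x) (iidLaw ℕ μ) := fun I J =>
    integrable_of_abs_le ((hψ.meas I).mul (hψ.meas J)) (B := B * B) fun x => by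
      rw [abs_mul]
      exact mul_le_mul (hψ.bound I x) (hψ.bound J x) (abs_nonneg _)
        ((abs_nonneg _).trans (hψ.bound I x))
  simp only [kernelSum, sq, Finset.sum_mul_sum]
  rw [integral_finsetSum _ fun I _ => integrable_finsetSum _ fun J _ => hint I J]
  refine Finset.sum_congr rfl fun I hI => ?_
  rw [integral_finsetSum _ fun J _ => hint I J]
  refine Finset.sum_eq_single_of_mem I hI fun J hJ hne => ?_
  have hI' := (Finset.mem_powersetCard.1 hI).2
  have hJ' := (Finset.mem_powersetCard.1 hJ).2
  have : ¬ I ⊆ J := fun h => hne (Finset.eq_of_subset_of_card_le h (by omega)).symm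
  obtain ⟨i, hi, hiJ⟩ := Finset.not_subset.1 this
  exact hψ.integral_mul_eq_zero hμ hi hiJ (hψ.meas J) (hψ.dep J)

/-- Kolmogorov's maximal inequality for sums of odd kernels. -/
theorem OddKernel.maximal_inequality (hψ : OddKernel ψ B)
    (hμ : MeasurePreserving (fun x : ℝ => -x) μ μ) (N : ℕ) {t : ℝ} (ht : 0 < t) :
    t ^ 2 * (iidLaw ℕ μ).real {x | ∃ n ≤ N, t ≤ |kernelSum ψ d n x|} ≤
      ∫ x, kernelSum ψ d N x ^ 2 ∂(iidLaw ℕ μ) := by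
  set M := kernelSum ψ d with hM
  have hMm : ∀ n, Measurable (M n) := fun n => hψ.measurable_kernelSum n
  -- `A m` is the event that the level `t` is first reached at time `m`; it depends on the
  -- coordinates below `m` only.
  let A : ℕ → Set (ℕ → ℝ) := fun m => {x | t ≤ |M m x| ∧ ∀ j < m, |M j x| < t}
  have hAm : ∀ m, MeasurableSet (A m) := fun m => by
    refine (measurableSet_le measurable_const (hMm m).abs).inter ?_
    have : {x | ∀ j < m, |M j x| < t} = ⋂ j ∈ Finset.range m, {x | |M j x| < t} := by
      ext; simp
    change MeasurableSet {x | ∀ j < m, |M j x| < t}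
    rw [this]
    exact Finset.measurableSet_biInter _ fun j _ => measurableSet_lt (hMm j).abs measurable_const
  have hdisj : ∀ i j, i < j → Disjoint (A i) (A j) := fun i j hij =>
    Set.disjoint_left.2 fun x hi hj => absurd hi.1 (not_le.2 (hj.2 i hij))
  have hAdep : ∀ m, DependsOn (fun x => (A m).indicator (fun _ => (1 : ℝ)) x)
      (Finset.range m : Set ℕ) := fun m x y h => by
    have e : ∀ j ≤ m, M j x = M j y := fun j hj =>
      hψ.dependsOn_kernelSum j fun i hi => h i (by simp at hi ⊢; omega)
    have : x ∈ A m ↔ y ∈ A m := by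
      simp only [A, Set.mem_ofPred_eq, e m le_rfl]
      refine and_congr_right fun _ => forall₂_congr fun j hj => by rw [e j hj.le]
    by_cases hx : x ∈ A m
    · simp [hx, this.1 hx]
    · simp [hx, mt this.2 hx]
  have hcover : {x | ∃ n ≤ N, t ≤ |M n x|} ⊆ ⋃ m ∈ Finset.range (N + 1), A m := by
    rintro x ⟨n, hn, hx⟩
    classical
    have hex : ∃ n, t ≤ |M n x| := ⟨n, hx⟩
    refine Set.mem_iUnion₂.2 ⟨Nat.find hex, ?_, Nat.find_spec hex, fun j hj =>
      not_le.1 (Nat.find_min hex hj)⟩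
    exact Finset.mem_range.2 (Nat.lt_succ_of_le ((Nat.find_min' hex hx).trans hn))
  have hbd : ∀ n x, |M n x| ≤ ((Finset.range n).powersetCard d).card * B :=
    fun n x => hψ.abs_kernelSum_le n x
  have hintM : Integrable (fun x => M N x ^ 2) (iidLaw ℕ μ) :=
    integrable_of_abs_le ((hMm N).pow_const 2) (fun x => by
      rw [abs_pow]; exact pow_le_pow_left₀ (abs_nonneg _) (hbd N x) 2)
  have hpiece : ∀ m ≤ N, t ^ 2 * (iidLaw ℕ μ).real (A m) ≤
      ∫ x in A m, M N x ^ 2 ∂(iidLaw ℕ μ) := by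
    intro m hm
    let φ : (ℕ → ℝ) → ℝ := fun x => M m x * (A m).indicator (fun _ => (1 : ℝ)) x
    have hφm : Measurable φ := (hMm m).mul (measurable_const.indicator (hAm m))
    have hφdep : DependsOn φ (Finset.range m : Set ℕ) := fun x y h => by
      have h1 : (A m).indicator (fun _ => (1 : ℝ)) x = (A m).indicator (fun _ => (1 : ℝ)) y :=
        hAdep m h
      have h2 : M m x = M m y := hψ.dependsOn_kernelSum m h
      simp only [φ, h1, h2]
    have hφb : ∀ x, |φ x| ≤ ((Finset.range m).powersetCard d).card * B := fun x => by
      simp only [φ]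
      by_cases hx : x ∈ A m
      · simpa [hx] using hbd m x
      · simpa [hx] using (abs_nonneg _).trans (hbd m x)
    -- Every kernel in the increment contains an index at least `m`, while `φ` depends on earlier
    -- coordinates.
    have hcross : ∫ x, (M N x - M m x) * φ x ∂(iidLaw ℕ μ) = 0 := by
      have hsub : (Finset.range m).powersetCard d ⊆ (Finset.range N).powersetCard d :=
        Finset.powersetCard_mono (Finset.range_mono hm)
      have : ∀ x, (M N x - M m x) * φ x =
          ∑ I ∈ (Finset.range N).powersetCard d \ (Finset.range m).powersetCard d,
            ψ I x * φ x := fun x => by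
        rw [← Finset.sum_mul, Finset.sum_sdiff_eq_sub hsub]; rfl
      simp only [this]
      have hint : ∀ I, Integrable (fun x => ψ I x * φ x) (iidLaw ℕ μ) := fun I =>
        integrable_of_abs_le ((hψ.meas I).mul hφm)
          (B := B * (((Finset.range m).powersetCard d).card * B)) fun x => by
            rw [abs_mul]
            exact mul_le_mul (hψ.bound I x) (hφb x) (abs_nonneg _)
              ((abs_nonneg _).trans (hψ.bound I x))
      rw [integral_finsetSum _ fun I _ => hint I]
      refine Finset.sum_eq_zero fun I hI => ?_
      rw [Finset.mem_sdiff, Finset.mem_powersetCard, Finset.mem_powersetCard] at hI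
      have : ¬ I ⊆ Finset.range m := fun h => hI.2 ⟨h, hI.1.2⟩
      obtain ⟨i, hi, him⟩ := Finset.not_subset.1 this
      exact hψ.integral_mul_eq_zero hμ hi him hφm hφdep
    have hi1 : Integrable (fun x => (A m).indicator (fun _ => t ^ 2) x) (iidLaw ℕ μ) :=
      (integrable_const _).indicator (hAm m)
    have hi2 : Integrable (fun x => (M N x - M m x) * φ x) (iidLaw ℕ μ) :=
      integrable_of_abs_le (((hMm N).sub (hMm m)).mul hφm) (fun x => by
        rw [abs_mul]
        exact mul_le_mul ((abs_sub _ _).trans (add_le_add (hbd N x) (hbd m x))) (hφb x)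
          (abs_nonneg _) (add_nonneg ((abs_nonneg _).trans (hbd N x))
            ((abs_nonneg _).trans (hbd m x))))
    -- Expand the square of `M N = M m + (M N - M m)`, drop the square of the increment and use `t ≤
    -- |M m|` on `A m`.
    have hle : ∀ x, (A m).indicator (fun _ => t ^ 2) x + 2 * ((M N x - M m x) * φ x) ≤
        (A m).indicator (fun x => M N x ^ 2) x := fun x => by
      by_cases hx : x ∈ A m
      · simp only [φ, Set.indicator_of_mem hx]
        have : t ^ 2 ≤ M m x ^ 2 := by
          rw [← sq_abs (M m x)]; exact pow_le_pow_left₀ ht.le hx.1 2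
        nlinarith [sq_nonneg (M N x - M m x)]
      · simp [φ, hx]
    have := integral_mono (hi1.add (hi2.const_mul 2)) (hintM.indicator (hAm m)) hle
    simp only [Pi.add_apply] at this
    rw [integral_add hi1 (hi2.const_mul 2), integral_const_mul, hcross,
      integral_indicator (hAm m), integral_indicator (hAm m)] at this
    simpa [mul_comm] using this
  have hpd : Set.PairwiseDisjoint (Finset.range (N + 1) : Set ℕ) A := fun i _ j _ hij => by
    rcases lt_or_gt_of_ne hij with h | h
    · exact hdisj i j h
    · exact (hdisj j i h).symm
  calc t ^ 2 * (iidLaw ℕ μ).real {x | ∃ n ≤ N, t ≤ |M n x|}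
      ≤ t ^ 2 * ∑ m ∈ Finset.range (N + 1), (iidLaw ℕ μ).real (A m) := by
        gcongr
        exact (measureReal_mono hcover (measure_ne_top _ _)).trans (measureReal_biUnion_finset_le _ _)
    _ ≤ ∑ m ∈ Finset.range (N + 1), ∫ x in A m, M N x ^ 2 ∂(iidLaw ℕ μ) := by
        rw [Finset.mul_sum]
        exact Finset.sum_le_sum fun m hm => hpiece m (by simp at hm; omega)
    _ = ∫ x in ⋃ m ∈ Finset.range (N + 1), A m, M N x ^ 2 ∂(iidLaw ℕ μ) :=
        (integral_biUnion_finset _ (fun m _ => hAm m) hpd fun m _ => hintM.integrableOn).symm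
    _ ≤ ∫ x, M N x ^ 2 ∂(iidLaw ℕ μ) :=
        setIntegral_le_integral hintM (Eventually.of_forall fun x => sq_nonneg _)

theorem card_powersetCard_range_le (d n : ℕ) :
    (((Finset.range n).powersetCard d).card : ℝ) ≤ (n : ℝ) ^ d := by
  rw [Finset.card_powersetCard, Finset.card_range]
  exact_mod_cast Nat.choose_le_pow n d

end OddKernels

/-! ### Increasing multi-indices as sets of size `d`. -/

theorem productSum_eq_kernelSum {Ω : Type*} (d : ℕ) (X : ℕ → Ω → ℝ) (n : ℕ) (ω : Ω) :
    productSum d X n ω = kernelSum (fun I x => ∏ i ∈ I, x i) d n fun i => X i ω := by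
  classical
  unfold productSum kernelSum increasingIndices
  have hmono : ∀ f : Fin d → Fin n, (∀ r s, r < s → f r < f s) →
      Function.Injective fun r => (f r : ℕ) := fun f hf r s h => by
    have hf' : StrictMono f := fun r s => hf r s
    exact hf'.injective (Fin.ext h)
  refine Finset.sum_bij' (fun f _ => Finset.univ.image fun r => (f r : ℕ))
    (fun I hI r => ⟨I.orderEmbOfFin (Finset.mem_powersetCard.1 hI).2 r, ?_⟩) ?_ ?_ ?_ ?_ ?_
  · exact Finset.mem_range.1 ((Finset.mem_powersetCard.1 hI).1 (Finset.orderEmbOfFin_mem _ _ _))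
  · intro f hf
    simp only [Finset.mem_filter, Finset.mem_univ, true_and] at hf
    rw [Finset.mem_powersetCard, Finset.card_image_of_injective _ (hmono f hf)]
    refine ⟨fun i hi => ?_, by simp⟩
    obtain ⟨r, -, rfl⟩ := Finset.mem_image.1 hi
    exact Finset.mem_range.2 (f r).2
  · intro I hI
    refine Finset.mem_filter.2 ⟨Finset.mem_univ _, fun r s hrs => ?_⟩
    rw [Fin.lt_def]
    exact (I.orderEmbOfFin _).strictMono hrs
  · intro f hf
    simp only [Finset.mem_filter, Finset.mem_univ, true_and] at hf
    ext r
    have := Finset.orderEmbOfFin_unique (s := Finset.univ.image fun r => (f r : ℕ)) (k := d)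
      (by rw [Finset.card_image_of_injective _ (hmono f hf)]; simp)
      (f := fun r => (f r : ℕ)) (fun r => Finset.mem_image_of_mem _ (Finset.mem_univ r))
      (fun r s h => hf r s h)
    exact (congrFun this r).symm
  · intro I hI
    exact Finset.image_orderEmbOfFin_univ I (Finset.mem_powersetCard.1 hI).2
  · intro f hf
    simp only [Finset.mem_filter, Finset.mem_univ, true_and] at hf
    dsimp only
    rw [Finset.prod_image fun r _ s _ h => hmono f hf h]

theorem prod_orderEmbOfFin {l : ℕ} (J : Finset ℕ) (h : J.card = l) (f : ℕ → ℝ) :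
    ∏ r : Fin l, f (J.orderEmbOfFin h r) = ∏ i ∈ J, f i := by
  conv_rhs => rw [← Finset.image_orderEmbOfFin_univ J h]
  rw [Finset.prod_image fun r _ s _ hrs => (J.orderEmbOfFin h).injective hrs]

/-! ### Truncated product kernels and their moments. -/

section Truncation

/-- The product kernel, set to zero where `∏ max (x_i ^ 2) g` exceeds `G`. -/
noncomputable def truncKernel (G g : ℝ) (I : Finset ℕ) (x : ℕ → ℝ) : ℝ :=
  if G < ∏ i ∈ I, max (x i ^ 2) g then 0 else ∏ i ∈ I, x i

/-- The event that `∏_{i ∈ J} x_i ^ 2 > G / g ^ m` and that all `x_i ^ 2`, `i ∈ J`, exceed `g`. -/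
def bigEvent {ι : Type*} (G g : ℝ) (m : ℕ) (J : Finset ι) : Set (ι → ℝ) :=
  {x | G / g ^ m < ∏ i ∈ J, x i ^ 2 ∧ ∀ i ∈ J, g < x i ^ 2}

/-- The probability of `bigEvent` for `l` independent variables with law `μ`. -/
noncomputable def bigProb (μ : Measure ℝ) (G g : ℝ) (m l : ℕ) : ℝ :=
  (iidLaw (Fin l) μ).real (bigEvent G g m Finset.univ)

theorem measurableSet_bigEvent {ι : Type*} (G g : ℝ) (m : ℕ) (J : Finset ι) :
    MeasurableSet (bigEvent G g m J) := by
  have h1 : Measurable fun x : ι → ℝ => ∏ i ∈ J, x i ^ 2 := by fun_prop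
  refine (measurableSet_lt measurable_const h1).inter ?_
  have : {x : ι → ℝ | ∀ i ∈ J, g < x i ^ 2} = ⋂ i ∈ J, {x | g < x i ^ 2} := by ext; simp
  change MeasurableSet {x : ι → ℝ | ∀ i ∈ J, g < x i ^ 2}
  rw [this]
  exact Finset.measurableSet_biInter _ fun i _ => measurableSet_lt measurable_const (by fun_prop)

variable {μ : Measure ℝ} [IsProbabilityMeasure μ] {G g : ℝ} {d : ℕ}

theorem measureReal_bigEvent (G g : ℝ) (m : ℕ) (J : Finset ℕ) :
    (iidLaw ℕ μ).real (bigEvent G g m J) = bigProb μ G g m J.card := by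
  have hp := measurePreserving_comp_injective (μ := μ) (J.orderEmbOfFin rfl).injective
  unfold bigProb
  rw [← hp.measureReal_preimage (measurableSet_bigEvent _ _ _ _).nullMeasurableSet]
  congr 1
  ext x
  have h1 := prod_orderEmbOfFin J rfl fun i => x i ^ 2
  have h2 : (∀ r, g < x (J.orderEmbOfFin rfl r) ^ 2) ↔ ∀ i ∈ J, g < x i ^ 2 := by
    refine ⟨fun h i hi => ?_, fun h r => h _ (Finset.orderEmbOfFin_mem _ _ _)⟩
    rw [← Finset.image_orderEmbOfFin_univ J rfl] at hi
    obtain ⟨r, -, rfl⟩ := Finset.mem_image.1 hi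
    exact h r
  simp only [bigEvent, Set.mem_preimage, Set.mem_ofPred_eq, h1, Finset.mem_univ, true_imp_iff, h2]

theorem dependsOn_bigEvent (G g : ℝ) (m : ℕ) (J : Finset ℕ) :
    DependsOn (· ∈ bigEvent G g m J) (J : Set ℕ) := fun x y h => by
  have h1 : ∏ i ∈ J, x i ^ 2 = ∏ i ∈ J, y i ^ 2 :=
    Finset.prod_congr rfl fun i hi => by rw [h i hi]
  simp only [bigEvent, Set.mem_ofPred_eq, h1, eq_iff_iff]
  exact and_congr_right fun _ => forall₂_congr fun i hi => by rw [h i hi]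

theorem measurable_prod_max (g : ℝ) (I : Finset ℕ) :
    Measurable fun x : ℕ → ℝ => ∏ i ∈ I, max (x i ^ 2) g :=
  Finset.measurable_fun_prod _ fun i _ => ((measurable_pi_apply i).pow_const 2).max measurable_const

theorem truncKernel_sq (G g : ℝ) (I : Finset ℕ) (x : ℕ → ℝ) :
    truncKernel G g I x ^ 2 =
      if G < ∏ i ∈ I, max (x i ^ 2) g then 0 else ∏ i ∈ I, x i ^ 2 := by
  unfold truncKernel
  split_ifs
  · simp
  · rw [Finset.prod_pow]

theorem truncKernel_sq_le (hG : 0 ≤ G) (g : ℝ) (I : Finset ℕ) (x : ℕ → ℝ) :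
    truncKernel G g I x ^ 2 ≤ G := by
  rw [truncKernel_sq]
  split_ifs with h
  · exact hG
  · exact (Finset.prod_le_prod (fun i _ => sq_nonneg _) fun i _ => le_max_left _ _).trans
      (not_lt.1 h)

theorem oddKernel_truncKernel (hG : 0 ≤ G) (g : ℝ) :
    OddKernel (truncKernel G g) (Real.sqrt G) where
  meas I := Measurable.ite (measurableSet_lt measurable_const (measurable_prod_max g I))
    measurable_const (Finset.measurable_fun_prod _ fun i _ => measurable_pi_apply i)
  bound I x := Real.abs_le_sqrt (truncKernel_sq_le hG g I x)
  dep I x y h := by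
    unfold truncKernel
    rw [Finset.prod_congr rfl fun i hi => by rw [h i hi],
      Finset.prod_congr rfl fun i hi => h i hi]
  odd I i hi x := by
    have h1 : ∀ j, signFlip {i} x j ^ 2 = x j ^ 2 := fun j => by
      unfold signFlip; split_ifs <;> simp
    have h2 : ∏ j ∈ I, signFlip {i} x j = -∏ j ∈ I, x j := by
      rw [← Finset.mul_prod_erase _ _ hi, ← Finset.mul_prod_erase _ _ hi, ← neg_mul]
      congr 1
      · simp [signFlip]
      · exact Finset.prod_congr rfl fun j hj => by
          simp [signFlip, Finset.ne_of_mem_erase hj]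
    simp only [truncKernel, h1, h2]
    split_ifs <;> simp

/-- The common second moment of the truncated product kernels of degree `d`. -/
noncomputable def truncMoment (μ : Measure ℝ) (G g : ℝ) (d : ℕ) : ℝ :=
  ∫ x, truncKernel G g (Finset.range d) x ^ 2 ∂(iidLaw ℕ μ)

theorem integral_truncKernel_sq (G g : ℝ) (I : Finset ℕ) :
    ∫ x, truncKernel G g I x ^ 2 ∂(iidLaw ℕ μ) = truncMoment μ G g I.card := by
  let Φ : (l : ℕ) → (Fin l → ℝ) → ℝ := fun l y =>
    if G < ∏ r, max (y r ^ 2) g then 0 else ∏ r, y r ^ 2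
  have hΦ : ∀ l, Measurable (Φ l) := fun l =>
    Measurable.ite (measurableSet_lt measurable_const (Finset.measurable_fun_prod _ fun i _ =>
      ((measurable_pi_apply i).pow_const 2).max measurable_const)) measurable_const
      (Finset.measurable_fun_prod _ fun i _ => (measurable_pi_apply i).pow_const 2)
  have key : ∀ (J : Finset ℕ) (l : ℕ) (h : J.card = l),
      ∫ x, truncKernel G g J x ^ 2 ∂(iidLaw ℕ μ) = ∫ y, Φ l y ∂(iidLaw (Fin l) μ) := by
    intro J l h
    have hp := measurePreserving_comp_injective (μ := μ) (J.orderEmbOfFin h).injective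
    rw [← hp.map_eq, integral_map hp.measurable.aemeasurable (hΦ l).aestronglyMeasurable]
    refine integral_congr_ae (Eventually.of_forall fun x => ?_)
    simp only [truncKernel_sq, Φ]
    rw [prod_orderEmbOfFin J h fun i => max (x i ^ 2) g, prod_orderEmbOfFin J h fun i => x i ^ 2]
  rw [key I I.card rfl, truncMoment, key (Finset.range I.card) I.card (Finset.card_range _)]

theorem prod_max_eq (x : ℕ → ℝ) (g : ℝ) (I : Finset ℕ) :
    ∏ i ∈ I, max (x i ^ 2) g = (∏ i ∈ I with g < x i ^ 2, x i ^ 2) *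
      g ^ (I.card - (I.filter fun i => g < x i ^ 2).card) := by
  rw [← Finset.prod_filter_mul_prod_filter_not I fun i => g < x i ^ 2]
  congr 1
  · exact Finset.prod_congr rfl fun i hi => max_eq_left (Finset.mem_filter.1 hi).2.le
  · rw [Finset.prod_congr rfl fun i hi => max_eq_right (not_lt.1 (Finset.mem_filter.1 hi).2),
      Finset.prod_const]
    congr 1
    have := Finset.card_filter_add_card_filter_not (s := I) (fun i => g < x i ^ 2)
    omega

/-- Coordinates outside the filter contribute a factor `g` each; dividing them out turns the
truncation condition into the event of (b). -/
theorem mem_bigEvent_filter (hg : 0 < g) {x : ℕ → ℝ} {I : Finset ℕ}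
    (h : G < ∏ i ∈ I, max (x i ^ 2) g) :
    x ∈ bigEvent G g (I.card - (I.filter fun i => g < x i ^ 2).card)
      (I.filter fun i => g < x i ^ 2) := by
  rw [prod_max_eq] at h
  exact ⟨(div_lt_iff₀ (pow_pos hg _)).2 h, fun i hi => (Finset.mem_filter.1 hi).2⟩

/-- A union bound over the sets `J` of coordinates with `x_i ^ 2 > g`, grouped by size; at most `N ^
l` of them have size `l`. -/
theorem measureReal_exists_exceedance_le (hg : 0 < g) (hgG : g ^ d ≤ G) (N : ℕ) :
    (iidLaw ℕ μ).real {x | ∃ I ∈ (Finset.range N).powersetCard d,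
      G < ∏ i ∈ I, max (x i ^ 2) g} ≤
      ∑ l ∈ Finset.Icc 1 d, (N : ℝ) ^ l * bigProb μ G g (d - l) l := by
  have hsub : {x : ℕ → ℝ | ∃ I ∈ (Finset.range N).powersetCard d,
      G < ∏ i ∈ I, max (x i ^ 2) g} ⊆
      ⋃ l ∈ Finset.Icc 1 d, ⋃ J ∈ (Finset.range N).powersetCard l, bigEvent G g (d - l) J := by
    rintro x ⟨I, hI, hx⟩
    obtain ⟨hIN, hId⟩ := Finset.mem_powersetCard.1 hI
    have hmem := mem_bigEvent_filter hg hx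
    have hle := Finset.card_filter_le I fun i => g < x i ^ 2
    rw [hId] at hmem hle
    refine Set.mem_iUnion₂.2 ⟨_, Finset.mem_Icc.2 ⟨?_, hle⟩, Set.mem_iUnion₂.2 ⟨_,
      Finset.mem_powersetCard.2 ⟨(Finset.filter_subset _ _).trans hIN, rfl⟩, hmem⟩⟩
    -- If no coordinate is large, the product of maxima is `g ^ d`, which does not exceed `G`.
    by_contra h0
    have h0 : (I.filter fun i => g < x i ^ 2).card = 0 := by omega
    rw [prod_max_eq, h0, Finset.card_eq_zero.1 h0, hId] at hx
    simp at hx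
    linarith
  refine (measureReal_mono hsub (measure_ne_top _ _)).trans
    ((measureReal_biUnion_finset_le _ _).trans (Finset.sum_le_sum fun l _ => ?_))
  refine (measureReal_biUnion_finset_le _ _).trans ?_
  rw [Finset.sum_congr rfl fun J hJ => by
    rw [measureReal_bigEvent, (Finset.mem_powersetCard.1 hJ).2], Finset.sum_const, nsmul_eq_mul]
  exact mul_le_mul_of_nonneg_right (card_powersetCard_range_le l N) measureReal_nonneg

theorem measurable_prod_min (g : ℝ) (s : Finset ℕ) :
    Measurable fun x : ℕ → ℝ => ∏ i ∈ s, min (x i ^ 2 / g) 1 :=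
  Finset.measurable_fun_prod _ fun i _ => by fun_prop

theorem integral_prod_min (g : ℝ) (s : Finset ℕ) :
    ∫ x, ∏ i ∈ s, min (x i ^ 2 / g) 1 ∂(iidLaw ℕ μ) = (∫ y, min (y ^ 2 / g) 1 ∂μ) ^ s.card := by
  have hm : Measurable fun y : ℝ => min (y ^ 2 / g) 1 := by fun_prop
  induction s using Finset.induction_on with
  | empty => simp
  | insert a s ha ih =>
    simp only [Finset.prod_insert ha]
    rw [integral_mul_of_dependsOn (f := fun x => min (x a ^ 2 / g) 1) (s := {a}) (t := s)
      (by fun_prop) (measurable_prod_min g s) (by simpa using ha),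
      ih, Finset.card_insert_of_notMem ha, pow_succ', ← Measure.infinitePi_map_eval (fun _ => μ) a,
      integral_map (measurable_pi_apply a).aemeasurable hm.aestronglyMeasurable]
    · rw [Measure.infinitePi_map_eval (fun _ => μ) a]
    · intro x y h; simp [h a (by simp)]
    · intro x y h; exact Finset.prod_congr rfl fun i hi => by rw [h i hi]

/-- The mean of `∏ min (x_i ^ 2 / g) 1` over the exceedance region `∏ max (x_i ^ 2) g > G`. -/
noncomputable def exceedMoment (μ : Measure ℝ) (G g : ℝ) (d : ℕ) : ℝ :=
  ∫ x, (if G < ∏ i ∈ Finset.range d, max (x i ^ 2) g then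
    ∏ i ∈ Finset.range d, min (x i ^ 2 / g) 1 else 0) ∂(iidLaw ℕ μ)

theorem prod_min_mem_Icc (hg : 0 < g) (s : Finset ℕ) (x : ℕ → ℝ) :
    0 ≤ ∏ i ∈ s, min (x i ^ 2 / g) 1 ∧ ∏ i ∈ s, min (x i ^ 2 / g) 1 ≤ 1 := by
  have h0 : ∀ i, 0 ≤ min (x i ^ 2 / g) 1 := fun i => le_min (by positivity) zero_le_one
  exact ⟨Finset.prod_nonneg fun i _ => h0 i,
    Finset.prod_le_one (fun i _ => h0 i) fun i _ => min_le_right _ _⟩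

/-- Split according to the set `J` of large coordinates. The event depends on `J` alone, so by
independence each coordinate outside `J` contributes a factor `∫ min (y ^ 2 / g) 1`. -/
theorem exceedMoment_le (hg : 0 < g) (hgG : g ^ d ≤ G) :
    exceedMoment μ G g d ≤ ∑ l ∈ Finset.Icc 1 d,
      (d.choose l : ℝ) * (bigProb μ G g (d - l) l * (∫ y, min (y ^ 2 / g) 1 ∂μ) ^ (d - l)) := by
  classical
  let φ := ∫ y, min (y ^ 2 / g) 1 ∂μ
  let F : Finset ℕ → (ℕ → ℝ) → ℝ := fun J x =>
    (bigEvent G g (d - J.card) J).indicator (fun _ => (1 : ℝ)) x *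
      ∏ i ∈ Finset.range d \ J, min (x i ^ 2 / g) 1
  have hFm : ∀ J, Measurable (F J) := fun J =>
    (measurable_const.indicator (measurableSet_bigEvent _ _ _ _)).mul (measurable_prod_min g _)
  have hF0 : ∀ J x, 0 ≤ F J x := fun J x =>
    mul_nonneg (Set.indicator_nonneg (fun _ _ => zero_le_one) _) (prod_min_mem_Icc hg _ x).1
  have hF1 : ∀ J x, F J x ≤ 1 := fun J x => by
    refine mul_le_one₀ ?_ (prod_min_mem_Icc hg _ x).1 (prod_min_mem_Icc hg _ x).2
    exact Set.indicator_le_self' (fun _ _ => zero_le_one) x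
  have hFi : ∀ J, Integrable (F J) (iidLaw ℕ μ) := fun J =>
    integrable_of_abs_le (hFm J) (B := 1) fun x => by
      rw [abs_of_nonneg (hF0 J x)]; exact hF1 J x
  have hFint : ∀ J ⊆ Finset.range d, ∫ x, F J x ∂(iidLaw ℕ μ) =
      bigProb μ G g (d - J.card) J.card * φ ^ (d - J.card) := fun J hJ => by
    simp only [F]
    rw [integral_mul_of_dependsOn (s := J) (t := Finset.range d \ J)
      (measurable_const.indicator (measurableSet_bigEvent _ _ _ _)) (measurable_prod_min g _)
      Finset.disjoint_sdiff, integral_prod_min g, Finset.card_sdiff_of_subset hJ,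
      Finset.card_range, integral_indicator (measurableSet_bigEvent _ _ _ _)]
    · simp [φ, measureReal_bigEvent]
    · intro x y h
      have := dependsOn_bigEvent G g (d - J.card) J h
      simp only [eq_iff_iff] at this
      by_cases hx : x ∈ bigEvent G g (d - J.card) J
      · simp [hx, this.1 hx]
      · simp [hx, mt this.2 hx]
    · intro x y h; exact Finset.prod_congr rfl fun i hi => by rw [h i hi]
  have hpt : ∀ x, (if G < ∏ i ∈ Finset.range d, max (x i ^ 2) g then
      ∏ i ∈ Finset.range d, min (x i ^ 2 / g) 1 else 0) ≤
      ∑ J ∈ (Finset.range d).powerset, F J x := fun x => by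
    split_ifs with h
    · have hmem := mem_bigEvent_filter hg h
      rw [Finset.card_range] at hmem
      refine le_trans ?_ (Finset.single_le_sum (fun J _ => hF0 J x)
        (Finset.mem_powerset.2 (Finset.filter_subset (fun i => g < x i ^ 2) (Finset.range d))))
      simp only [F, Set.indicator_of_mem hmem, one_mul]
      rw [← Finset.prod_sdiff (Finset.filter_subset (fun i => g < x i ^ 2) (Finset.range d))]
      exact mul_le_of_le_one_right (prod_min_mem_Icc hg _ x).1 (prod_min_mem_Icc hg _ x).2
    · exact Finset.sum_nonneg fun J _ => hF0 J x
  have hint : Integrable (fun x => if G < ∏ i ∈ Finset.range d, max (x i ^ 2) g then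
      ∏ i ∈ Finset.range d, min (x i ^ 2 / g) 1 else 0) (iidLaw ℕ μ) := by
    refine integrable_of_abs_le (Measurable.ite (measurableSet_lt measurable_const
      (measurable_prod_max g _)) (measurable_prod_min g _) measurable_const) (B := 1) fun x => ?_
    split_ifs
    · rw [abs_of_nonneg (prod_min_mem_Icc hg _ x).1]; exact (prod_min_mem_Icc hg _ x).2
    · simp
  -- The empty `J` would require `G / g ^ d < 1`, so the sum starts at `l = 1`.
  have h0 : bigProb μ G g d 0 = 0 := by
    have : bigEvent G g d (Finset.univ : Finset (Fin 0)) = ∅ := by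
      ext x
      simp only [bigEvent, Finset.univ_eq_empty, Finset.prod_empty, Set.mem_ofPred_eq,
        Set.mem_empty_iff_false, iff_false, not_and]
      intro h
      rw [div_lt_one (pow_pos hg d)] at h
      linarith
    rw [bigProb, this, measureReal_empty]
  calc exceedMoment μ G g d
      ≤ ∫ x, ∑ J ∈ (Finset.range d).powerset, F J x ∂(iidLaw ℕ μ) :=
        integral_mono hint (integrable_finsetSum _ fun J _ => hFi J) hpt
    _ = ∑ J ∈ (Finset.range d).powerset,
          bigProb μ G g (d - J.card) J.card * φ ^ (d - J.card) := by
        rw [integral_finsetSum _ fun J _ => hFi J]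
        exact Finset.sum_congr rfl fun J hJ => hFint J (Finset.mem_powerset.1 hJ)
    _ = ∑ l ∈ Finset.range (d + 1),
          (d.choose l : ℝ) * (bigProb μ G g (d - l) l * φ ^ (d - l)) := by
        rw [Finset.sum_powerset_apply_card fun l => bigProb μ G g (d - l) l * φ ^ (d - l)]
        simp
    _ = _ := by
        refine (Finset.sum_subset (fun l hl => ?_) fun l hl hl' => ?_).symm
        · rw [Finset.mem_Icc] at hl; exact Finset.mem_range.2 (by omega)
        · rw [Finset.mem_Icc] at hl'
          rw [Finset.mem_range] at hl
          obtain rfl : l = 0 := by omega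
          simp [h0]

/-- Only points cut at level `(G, g)` but kept at `(G', g')` are new. There `∏ x_i ^ 2 = ∏ max (x_i
^ 2) g * ∏ min (x_i ^ 2 / g) 1`, and the first product is at most `∏ max (x_i ^ 2) g' ≤ G'`. -/
theorem truncMoment_le (hg : 0 < g) {G' g' : ℝ} (hgg : g ≤ g') (hG : 0 ≤ G) (hG' : 0 ≤ G') :
    truncMoment μ G' g' d ≤ truncMoment μ G g d + G' * exceedMoment μ G g d := by
  unfold truncMoment exceedMoment
  have hsq : ∀ {A a : ℝ}, 0 ≤ A →
      Integrable (fun x => truncKernel A a (Finset.range d) x ^ 2) (iidLaw ℕ μ) := fun {A a} hA =>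
    integrable_of_abs_le (((oddKernel_truncKernel hA a).meas _).pow_const 2) (B := A) fun x => by
      rw [abs_of_nonneg (sq_nonneg _)]; exact truncKernel_sq_le hA a _ x
  have hint : Integrable (fun x => if G < ∏ i ∈ Finset.range d, max (x i ^ 2) g then
      ∏ i ∈ Finset.range d, min (x i ^ 2 / g) 1 else 0) (iidLaw ℕ μ) := by
    refine integrable_of_abs_le (Measurable.ite (measurableSet_lt measurable_const
      (measurable_prod_max g _)) (measurable_prod_min g _) measurable_const) (B := 1) fun x => ?_
    split_ifs
    · rw [abs_of_nonneg (prod_min_mem_Icc hg _ x).1]; exact (prod_min_mem_Icc hg _ x).2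
    · simp
  rw [← integral_const_mul, ← integral_add (hsq hG) (hint.const_mul _)]
  refine integral_mono (hsq hG') ((hsq hG).add (hint.const_mul _)) fun x => ?_
  simp only [truncKernel_sq]
  have hmono : ∏ i ∈ Finset.range d, max (x i ^ 2) g ≤ ∏ i ∈ Finset.range d, max (x i ^ 2) g' :=
    Finset.prod_le_prod (fun i _ => (sq_nonneg _).trans (le_max_left _ _))
      fun i _ => max_le_max le_rfl hgg
  have hfac : ∏ i ∈ Finset.range d, x i ^ 2 = (∏ i ∈ Finset.range d, max (x i ^ 2) g) *
      ∏ i ∈ Finset.range d, min (x i ^ 2 / g) 1 := by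
    rw [← Finset.prod_mul_distrib]
    refine Finset.prod_congr rfl fun i _ => ?_
    rcases le_total (x i ^ 2) g with h | h
    · rw [max_eq_right h, min_eq_left ((div_le_one hg).2 h)]; field_simp
    · rw [max_eq_left h, min_eq_right ((one_le_div hg).2 h), mul_one]
  have hnn := (prod_min_mem_Icc hg (Finset.range d) x).1
  have hsqnn : 0 ≤ ∏ i ∈ Finset.range d, x i ^ 2 := Finset.prod_nonneg fun i _ => sq_nonneg _
  split_ifs with h1 h2 h2
  · simpa using mul_nonneg hG' hnn
  · simpa using hsqnn
  · rw [hfac, zero_add]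
    exact mul_le_mul_of_nonneg_right (hmono.trans (not_lt.1 h1)) hnn
  · simp

end Truncation

/-! ### Contractive recursions and the regularity series. -/

section Sequences

/-- Summing the recursion bounds a partial sum by `ρ` times itself plus a constant. -/
theorem summable_of_contraction {x y : ℕ → ℝ} {ρ : ℝ} {k₀ : ℕ} (hx : ∀ k, 0 ≤ x k)
    (hy : ∀ k, 0 ≤ y k) (hρ : ρ < 1) (hy' : Summable y)
    (h : ∀ k, k₀ ≤ k → x (k + 1) ≤ ρ * x k + y k) : Summable x := by
  rw [← summable_nat_add_iff k₀]
  set z : ℕ → ℝ := fun k => x (k + k₀)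
  have hys := (summable_nat_add_iff k₀).2 hy'
  refine summable_of_sum_range_le (c := (z 0 + ∑' k, y (k + k₀)) / (1 - ρ))
    (fun k => hx _) fun n => ?_
  rw [le_div_iff₀ (by linarith)]
  have h1 : ∑ k ∈ Finset.range (n + 1), z k ≤ z 0 + ρ * ∑ k ∈ Finset.range n, z k +
      ∑ k ∈ Finset.range n, y (k + k₀) := by
    rw [Finset.sum_range_succ', Finset.mul_sum, add_assoc, ← Finset.sum_add_distrib, add_comm]
    gcongr with k
    have := h (k + k₀) (by omega)
    simp only [z]
    rwa [show k + 1 + k₀ = k + k₀ + 1 by omega]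
  have h2 : ∑ k ∈ Finset.range n, z k ≤ ∑ k ∈ Finset.range (n + 1), z k := by
    rw [Finset.sum_range_succ]; exact le_add_of_nonneg_right (hx _)
  have h3 := hys.sum_le_tsum (Finset.range n) fun k _ => hy _
  linarith

/-- Once `ε k` is small, the term with `h (k + 1)` on the right is absorbed by the left. The
resulting affine recursion has fixed point `1 / 2`, strictly below `1`. -/
theorem eventually_le_one_of_contraction {h ε : ℕ → ℝ} {ρ : ℝ} (hh : ∀ k, 0 ≤ h k)
    (hρ0 : 0 ≤ ρ) (hρ : ρ < 1) (hε : Tendsto ε atTop (𝓝 0))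
    (hrec : ∀ᶠ k in atTop, h (k + 1) ≤ ρ * h k + ε k * (1 + h (k + 1))) :
    ∀ᶠ k in atTop, h k ≤ 1 := by
  -- Small enough that dividing by `1 - δ` raises `ρ` to at most `ρ' = (1 + ρ) / 2` and `δ` to at
  -- most `(1 - ρ') / 2`.
  set δ := (1 - ρ) / 8 with hδ
  have hδ0 : 0 < δ := by rw [hδ]; linarith
  obtain ⟨k₀, hk₀⟩ := eventually_atTop.1 (hrec.and (hε.eventually (ge_mem_nhds hδ0)))
  set ρ' := (1 + ρ) / 2 with hρ'
  have step : ∀ k, k₀ ≤ k → h (k + 1) ≤ ρ' * h k + (1 - ρ') / 2 := fun k hk => by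
    obtain ⟨h1, h2⟩ := hk₀ k hk
    have h3 : ε k * (1 + h (k + 1)) ≤ δ * (1 + h (k + 1)) :=
      mul_le_mul_of_nonneg_right h2 (by linarith [hh (k + 1)])
    have hk0 := hh k
    have h4 : (1 - δ) * h (k + 1) ≤ ρ * h k + δ := by linarith
    have h5 : ρ ≤ (1 - δ) * ρ' := by rw [hδ, hρ']; nlinarith
    have h6 : δ ≤ (1 - δ) * ((1 - ρ') / 2) := by rw [hδ, hρ']; nlinarith
    have h7 : (1 - δ) * h (k + 1) ≤ (1 - δ) * (ρ' * h k + (1 - ρ') / 2) := by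
      nlinarith [mul_le_mul_of_nonneg_right h5 hk0]
    exact le_of_mul_le_mul_left h7 (by rw [hδ]; linarith)
  have iter : ∀ j, h (k₀ + j) ≤ ρ' ^ j * h k₀ + 1 / 2 := fun j => by
    induction j with
    | zero => simp
    | succ j ih =>
      have := step (k₀ + j) (by omega)
      have h' : ρ' * h (k₀ + j) ≤ ρ' * (ρ' ^ j * h k₀ + 1 / 2) :=
        mul_le_mul_of_nonneg_left ih (by rw [hρ']; linarith)
      rw [← add_assoc, pow_succ]
      linarith
  have hlim : Tendsto (fun j => ρ' ^ j * h k₀) atTop (𝓝 0) := by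
    simpa using (tendsto_pow_atTop_nhds_zero_of_lt_one (r := ρ') (by rw [hρ']; linarith)
      (by rw [hρ']; linarith)).mul_const (h k₀)
  obtain ⟨j₀, hj₀⟩ := eventually_atTop.1 (hlim.eventually (ge_mem_nhds (show (0 : ℝ) < 1 / 2 by norm_num)))
  refine eventually_atTop.2 ⟨k₀ + j₀, fun k hk => ?_⟩
  obtain ⟨j, rfl⟩ := Nat.exists_eq_add_of_le (show k₀ ≤ k by omega)
  linarith [iter j, hj₀ j (by omega)]

/-- The tail sums of the regularity series dominate its terms and decay geometrically. -/
theorem RegularNormalizing.exists_geometric {d : ℕ} {γ : ℕ → ℝ} (hγ : RegularNormalizing d γ) :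
    ∃ (R : ℕ → ℝ) (ρ C : ℝ), 0 ≤ ρ ∧ ρ < 1 ∧ 0 < C ∧ (∀ k, 0 ≤ R k) ∧
      ∀ k, 1 ≤ k → R (k + 1) ≤ ρ * R k ∧
      (2 : ℝ) ^ (d * k) / γ (2 ^ k) ^ 2 ≤ R k ∧
      R k ≤ C * ((2 : ℝ) ^ (d * k) / γ (2 ^ k) ^ 2) := by
  obtain ⟨C, hC⟩ := hγ.series
  set b : ℕ → ℝ := fun k => (2 : ℝ) ^ (d * k) / γ (2 ^ k) ^ 2 with hb
  have hb0 : ∀ k, 0 < b k := fun k =>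
    div_pos (by positivity) (pow_pos (hγ.pos _ Nat.one_le_two_pow) 2)
  set R : ℕ → ℝ := fun k => ∑' j, b (k + j)
  have hR : ∀ k, 1 ≤ k → R k = b k + R (k + 1) := fun k hk => by
    have := (hC k hk).1.tsum_eq_zero_add
    simp only [R]
    rw [this]
    congr 2
    ext j
    simp only [hb]
    rw [show k + (j + 1) = k + 1 + j by omega]
  have hR0 : ∀ k, 0 ≤ R k := fun k => tsum_nonneg fun j => (hb0 _).le
  have hbR : ∀ k, 1 ≤ k → b k ≤ R k := fun k hk => by rw [hR k hk]; linarith [hR0 (k + 1)]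
  have hRC : ∀ k, 1 ≤ k → R k ≤ C * b k := fun k hk => (hC k hk).2
  have hC1 : 1 ≤ C := by
    have := (hbR 1 le_rfl).trans (hRC 1 le_rfl)
    exact le_of_mul_le_mul_right (by simpa using this) (hb0 1)
  have hC0 : 0 < C := by linarith
  -- `R (k + 1) = R k - b k` and `b k ≥ R k / C` give the ratio `1 - 1 / C`.
  refine ⟨R, 1 - 1 / C, C, ?_, ?_, hC0, hR0, fun k hk => ⟨?_, hbR k hk, hRC k hk⟩⟩
  · have : 1 / C ≤ 1 := by rw [div_le_one hC0]; exact hC1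
    linarith
  · have : 0 < 1 / C := by positivity
    linarith
  · have h1 : 1 / C * R k ≤ b k := by
      rw [one_div, inv_mul_le_iff₀ hC0]; exact hRC k hk
    linarith [hR k hk]

end Sequences

/-! ### The truncation level is positive and attained for large `n`. -/

section TruncationLevel

variable {μ : Measure ℝ} [IsProbabilityMeasure μ]

theorem integrable_min_sq_div (g : ℝ) : Integrable (fun y : ℝ => min (y ^ 2 / g ^ 2) 1) μ :=
  integrable_of_abs_le (by fun_prop) (B := 1) fun y => by
    rw [abs_of_nonneg (le_min (by positivity) zero_le_one)]; exact min_le_right _ _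

theorem integral_min_sq_div_anti {a c : ℝ} (ha : 0 < a) (hac : a ≤ c) :
    ∫ y, min (y ^ 2 / c ^ 2) 1 ∂μ ≤ ∫ y, min (y ^ 2 / a ^ 2) 1 ∂μ :=
  integral_mono (integrable_min_sq_div c) (integrable_min_sq_div a) fun y =>
    min_le_min_right 1 (by dsimp only; gcongr)

theorem tendsto_integral_min_sq_div {l : Filter ℝ} [l.IsCountablyGenerated] {f : ℝ → ℝ}
    (h : ∀ y : ℝ, Tendsto (fun c => min (y ^ 2 / c ^ 2) 1) l (𝓝 (f y))) :
    Tendsto (fun c => ∫ y, min (y ^ 2 / c ^ 2) 1 ∂μ) l (𝓝 (∫ y, f y ∂μ)) := by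
  refine tendsto_integral_filter_of_dominated_convergence (fun _ => 1) ?_ ?_
    (integrable_const 1) (Eventually.of_forall h)
  · exact Eventually.of_forall fun c => (integrable_min_sq_div c).aestronglyMeasurable
  · refine Eventually.of_forall fun c => Eventually.of_forall fun y => ?_
    rw [Real.norm_eq_abs, abs_of_nonneg (le_min (by positivity) zero_le_one)]
    exact min_le_right _ _

theorem truncLevel_set_nonempty (n : ℕ) :
    {c : ℝ | 0 < c ∧ (n : ℝ) * ∫ y, min (id y ^ 2 / c ^ 2) 1 ∂μ ≤ 1}.Nonempty := by
  have h1 : Tendsto (fun c => ∫ y, min (y ^ 2 / c ^ 2) 1 ∂μ) atTop (𝓝 (∫ _, (0 : ℝ) ∂μ)) := by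
    refine tendsto_integral_min_sq_div fun y => ?_
    have := (tendsto_const_nhds (x := y ^ 2)).div_atTop
      (tendsto_pow_atTop (α := ℝ) (two_ne_zero))
    simpa using this.min (tendsto_const_nhds (x := (1 : ℝ)))
  rw [integral_zero] at h1
  have h2 := h1.const_mul (n : ℝ)
  rw [mul_zero] at h2
  obtain ⟨c, hc⟩ := ((h2.eventually (ge_mem_nhds zero_lt_one)).and (eventually_gt_atTop 0)).exists
  exact ⟨c, hc.2, hc.1⟩

theorem truncLevel_set_bddBelow {ν : Measure ℝ} (n : ℕ) :
    BddBelow {c : ℝ | 0 < c ∧ (n : ℝ) * ∫ y, min (id y ^ 2 / c ^ 2) 1 ∂ν ≤ 1} :=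
  ⟨0, fun _ hc => hc.1.le⟩

theorem truncLevel_mono {m n : ℕ} (hmn : m ≤ n) : truncLevel μ id m ≤ truncLevel μ id n := by
  refine csInf_le_csInf (truncLevel_set_bddBelow m) (truncLevel_set_nonempty n) fun c hc =>
    ⟨hc.1, le_trans (mul_le_mul_of_nonneg_right (Nat.cast_le.2 hmn) ?_) hc.2⟩
  exact integral_nonneg fun y => le_min (by positivity) zero_le_one

/-- As `c` decreases to `0`, the truncated moment tends to `P(X ≠ 0)` by dominated convergence, so
no small `c` is admissible. -/
theorem truncLevel_pos {n : ℕ} (hn : 1 < n * μ.real {0}ᶜ) : 0 < truncLevel μ id n := by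
  have h1 : Tendsto (fun c => ∫ y, min (y ^ 2 / c ^ 2) 1 ∂μ) (𝓝[>] 0)
      (𝓝 (∫ y, ({0}ᶜ : Set ℝ).indicator (fun _ => (1 : ℝ)) y ∂μ)) := by
    refine tendsto_integral_min_sq_div fun y => ?_
    by_cases hy : y = 0
    · simp [hy]
    · rw [Set.indicator_of_mem (by simpa using hy)]
      refine tendsto_const_nhds.congr' ?_
      filter_upwards [Ioc_mem_nhdsGT (abs_pos.2 hy)] with c hc
      rw [eq_comm, min_eq_right]
      rw [one_le_div (pow_pos hc.1 2), ← sq_abs y]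
      exact pow_le_pow_left₀ hc.1.le hc.2 2
  rw [integral_indicator (measurableSet_singleton 0).compl] at h1
  simp only [integral_const, measureReal_restrict_apply_univ, smul_eq_mul, mul_one] at h1
  obtain ⟨a, ha, ha0⟩ := (((h1.const_mul (n : ℝ)).eventually (lt_mem_nhds hn)).and
    self_mem_nhdsWithin).exists
  refine lt_of_lt_of_le ha0 (le_csInf (truncLevel_set_nonempty n) fun c hc => ?_)
  by_contra hlt
  have := integral_min_sq_div_anti (μ := μ) hc.1 (not_le.1 hlt).le
  have h2 := mul_le_mul_of_nonneg_left this n.cast_nonneg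
  have h3 := hc.2
  simp only [id] at h3
  linarith

/-- The truncated moment is continuous at a positive level: a limit of admissible levels is
admissible, and strict inequality would allow a smaller one. -/
theorem truncLevel_eq_one {n : ℕ} (hn : 1 < n * μ.real {0}ᶜ) :
    (n : ℝ) * ∫ y, min (y ^ 2 / truncLevel μ id n ^ 2) 1 ∂μ = 1 := by
  set c₀ := truncLevel μ id n with hc₀
  have hpos : 0 < c₀ := truncLevel_pos hn
  have hcont : Tendsto (fun c => (n : ℝ) * ∫ y, min (y ^ 2 / c ^ 2) 1 ∂μ) (𝓝 c₀)
      (𝓝 ((n : ℝ) * ∫ y, min (y ^ 2 / c₀ ^ 2) 1 ∂μ)) := by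
    refine (tendsto_integral_min_sq_div fun y => ?_).const_mul _
    have hca : ContinuousAt (fun c : ℝ => min (y ^ 2 / c ^ 2) 1) c₀ :=
      ((continuousAt_const (y := y ^ 2)).div (continuousAt_id.pow 2)
        (pow_pos hpos 2).ne').min continuousAt_const
    exact hca
  apply le_antisymm
  · obtain ⟨u, -, hu, hmem⟩ := exists_seq_tendsto_sInf (truncLevel_set_nonempty (μ := μ) n)
      (truncLevel_set_bddBelow n)
    exact le_of_tendsto (hcont.comp hu) (Eventually.of_forall fun k => (hmem k).2)
  · by_contra hlt
    have hev := (hcont.eventually (ge_mem_nhds (not_le.1 hlt))).and (lt_mem_nhds hpos)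
    obtain ⟨δ, hδ, hball⟩ := Metric.eventually_nhds_iff.1 hev
    have hmem := hball (y := c₀ - δ / 2) (by
      rw [Real.dist_eq, show c₀ - δ / 2 - c₀ = -(δ / 2) by ring, abs_neg, abs_of_pos] <;> linarith)
    have : c₀ ≤ c₀ - δ / 2 := csInf_le (truncLevel_set_bddBelow n) ⟨hmem.2, hmem.1⟩
    linarith

theorem eventually_one_lt_mul_measure {ν : Measure ℝ} (h : ν.real {0}ᶜ ≠ 0) :
    ∀ᶠ k : ℕ in atTop, 1 < ((2 ^ k : ℕ) : ℝ) * ν.real {0}ᶜ := by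
  have h0 : 0 < ν.real {0}ᶜ := lt_of_le_of_ne measureReal_nonneg (Ne.symm h)
  have := (tendsto_pow_atTop_atTop_of_one_lt (r := (2 : ℝ)) one_lt_two).atTop_mul_const h0
  filter_upwards [this.eventually_gt_atTop 1] with k hk
  exact_mod_cast hk

end TruncationLevel

/-! ### Comparison of `c_n ^ 2` with `γ_n ^ (2 / d)`. -/

section LevelComparison

variable {μ : Measure ℝ} [IsProbabilityMeasure μ]

theorem integrable_min_sq {τ : ℝ} (hτ : 0 ≤ τ) : Integrable (fun y : ℝ => min (y ^ 2) τ) μ :=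
  integrable_of_abs_le (by fun_prop) (B := τ) fun y => by
    rw [abs_of_nonneg (le_min (by positivity) hτ)]; exact min_le_right _ _

theorem integral_min_sq_le_add {τ τ' : ℝ} (hτ : 0 ≤ τ) (h : τ ≤ τ') :
    ∫ y, min (y ^ 2) τ' ∂μ ≤ ∫ y, min (y ^ 2) τ ∂μ + τ' * μ.real {y | τ < y ^ 2} := by
  have hm : MeasurableSet {y : ℝ | τ < y ^ 2} := measurableSet_lt measurable_const (by fun_prop)
  have hi : Integrable ({y : ℝ | τ < y ^ 2}.indicator fun _ => τ') μ :=
    (integrable_const τ').indicator hm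
  have : τ' * μ.real {y | τ < y ^ 2} = ∫ y, {y : ℝ | τ < y ^ 2}.indicator (fun _ => τ') y ∂μ := by
    rw [integral_indicator hm]; simp [mul_comm]
  rw [this, ← integral_add (integrable_min_sq hτ) hi]
  refine integral_mono (integrable_min_sq (hτ.trans h)) ((integrable_min_sq hτ).add hi) fun y => ?_
  by_cases hy : τ < y ^ 2
  · simp only [Set.indicator_of_mem (show y ∈ {y : ℝ | τ < y ^ 2} from hy)]
    have := le_min (sq_nonneg y) hτ
    linarith [min_le_right (y ^ 2) τ']
  · simp only [Set.indicator_of_notMem (show y ∉ {y : ℝ | τ < y ^ 2} from hy)]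
    have hy' := not_lt.1 hy
    rw [min_eq_left hy', min_eq_left (hy'.trans h), add_zero]

/-- The quantity `h k = r k * ∫ min (y ^ 2) (τ k)`, `τ = max g θ`, dominates `g k / θ k` because `g
k = 2 ^ k ∫ min (y ^ 2) (g k)`. Raising the cap from `τ k` to `τ (k + 1)` costs at most `τ (k + 1)
P(X ^ 2 > τ k)`, which is a small multiple of `1 + h (k + 1)` after normalization; so `h` contracts
below `1`. -/
theorem eventually_level_le {g θ r : ℕ → ℝ} {ρ K : ℝ} {k₀ : ℕ} (hρ0 : 0 ≤ ρ) (hρ : ρ < 1)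
    (hr0 : ∀ k, 0 ≤ r k) (hK : 0 ≤ K)
    (hg : ∀ k, k₀ ≤ k → 0 < g k ∧ g k ≤ g (k + 1) ∧
      (2 : ℝ) ^ k * ∫ y, min (y ^ 2 / g k) 1 ∂μ = 1)
    (hθ : ∀ k, k₀ ≤ k → 0 < θ k ∧ θ k ≤ θ (k + 1))
    (hr : ∀ k, k₀ ≤ k → r (k + 1) ≤ ρ * r k ∧ (2 : ℝ) ^ k / θ k ≤ r k ∧
      r k ≤ K * ((2 : ℝ) ^ k / θ k))
    (hs : Tendsto (fun k => (2 : ℝ) ^ k * μ.real {y | max (g k) (θ k) < y ^ 2}) atTop (𝓝 0)) :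
    ∀ᶠ k in atTop, g k ≤ θ k := by
  set τ : ℕ → ℝ := fun k => max (g k) (θ k) with hτ
  set s : ℕ → ℝ := fun k => (2 : ℝ) ^ k * μ.real {y | τ k < y ^ 2} with hsdef
  -- The inner maximum with `0` only ensures nonnegativity of `h` for indices below `k₀`.
  set h : ℕ → ℝ := fun k => r k * ∫ y, min (y ^ 2) (max (τ k) 0) ∂μ with hh
  have hint0 : ∀ t : ℝ, 0 ≤ t → 0 ≤ ∫ y, min (y ^ 2) t ∂μ := fun t ht =>
    integral_nonneg fun y => le_min (sq_nonneg y) ht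
  have hτ0 : ∀ k, k₀ ≤ k → 0 < τ k := fun k hk => lt_max_of_lt_left (hg k hk).1
  have hgh : ∀ k, k₀ ≤ k → g k / θ k ≤ h k := fun k hk => by
    have hgk := (hg k hk).1
    have e1 : g k = (2 : ℝ) ^ k * ∫ y, min (y ^ 2) (g k) ∂μ := by
      have : ∀ y : ℝ, min (y ^ 2) (g k) = g k * min (y ^ 2 / g k) 1 := fun y => by
        rw [mul_min_of_nonneg _ _ hgk.le, mul_one, mul_div_cancel₀ _ hgk.ne']
      simp only [this, integral_const_mul]
      rw [mul_left_comm, (hg k hk).2.2, mul_one]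
    have e2 : ∫ y, min (y ^ 2) (g k) ∂μ ≤ ∫ y, min (y ^ 2) (max (τ k) 0) ∂μ := by
      rw [max_eq_left (hτ0 k hk).le]
      exact integral_mono (integrable_min_sq hgk.le) (integrable_min_sq (hτ0 k hk).le) fun y =>
        min_le_min_left _ (le_max_left _ _)
    calc g k / θ k = (2 : ℝ) ^ k / θ k * ∫ y, min (y ^ 2) (g k) ∂μ := by
          conv_lhs => rw [e1]
          ring
      _ ≤ h k := mul_le_mul (hr k hk).2.1 e2 (hint0 _ hgk.le) (hr0 k)
  have hev : ∀ᶠ k in atTop, h k ≤ 1 := by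
    refine eventually_le_one_of_contraction (ε := fun k => 2 * K * s k)
      (fun k => mul_nonneg (hr0 k) (hint0 _ (le_max_right _ _))) hρ0 hρ
      (by simpa using hs.const_mul (2 * K)) (eventually_atTop.2 ⟨k₀, fun k hk => ?_⟩)
    have hk1 : k₀ ≤ k + 1 := by omega
    have hττ : τ k ≤ τ (k + 1) := max_le_max (hg k hk).2.1 (hθ k hk).2
    have hθ1 := (hθ _ hk1).1
    have h1 := integral_min_sq_le_add (μ := μ) (hτ0 k hk).le hττ
    -- A maximum is at most the sum, and `g / θ ≤ h`; the bound thus involves `h (k + 1)` itself.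
    have h2 : τ (k + 1) / θ (k + 1) ≤ 1 + h (k + 1) := by
      refine le_trans ?_ (add_le_add_right (hgh _ hk1) 1)
      rw [div_le_iff₀ hθ1, add_mul, div_mul_cancel₀ _ hθ1.ne', one_mul]
      exact max_le (by linarith) (by linarith [(hg _ hk1).1])
    have h3 : r (k + 1) * (τ (k + 1) * μ.real {y | τ k < y ^ 2}) ≤
        2 * K * s k * (1 + h (k + 1)) := by
      calc r (k + 1) * (τ (k + 1) * μ.real {y | τ k < y ^ 2})
          ≤ K * ((2 : ℝ) ^ (k + 1) / θ (k + 1)) * (τ (k + 1) * μ.real {y | τ k < y ^ 2}) :=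
            mul_le_mul_of_nonneg_right (hr _ hk1).2.2
              (mul_nonneg (hτ0 _ hk1).le measureReal_nonneg)
        _ = 2 * K * s k * (τ (k + 1) / θ (k + 1)) := by
            simp only [hsdef]; rw [pow_succ]; ring
        _ ≤ _ := mul_le_mul_of_nonneg_left h2 (mul_nonneg (by linarith)
            (mul_nonneg (by positivity) measureReal_nonneg))
    calc h (k + 1) = r (k + 1) * ∫ y, min (y ^ 2) (τ (k + 1)) ∂μ := by
          simp only [hh]; rw [max_eq_left (hτ0 _ hk1).le]
      _ ≤ r (k + 1) * (∫ y, min (y ^ 2) (τ k) ∂μ + τ (k + 1) * μ.real {y | τ k < y ^ 2}) :=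
          mul_le_mul_of_nonneg_left h1 (hr0 _)
      _ = r (k + 1) * (∫ y, min (y ^ 2) (τ k) ∂μ) +
          r (k + 1) * (τ (k + 1) * μ.real {y | τ k < y ^ 2}) := mul_add _ _ _
      _ ≤ ρ * r k * (∫ y, min (y ^ 2) (τ k) ∂μ) + 2 * K * s k * (1 + h (k + 1)) :=
          add_le_add (mul_le_mul_of_nonneg_right (hr k hk).1 (hint0 _ (hτ0 k hk).le)) h3
      _ = ρ * h k + 2 * K * s k * (1 + h (k + 1)) := by
          simp only [hh]; rw [max_eq_left (hτ0 k hk).le]; ring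
  filter_upwards [hev, eventually_ge_atTop k₀] with k hk hk₀
  have := (hgh k hk₀).trans hk
  rwa [div_le_one (hθ k hk₀).1] at this

end LevelComparison

/-! ### From the series conditions to almost sure convergence. -/

section Sufficiency

theorem ae_eventually_notMem_of_summable {Ω : Type*} [MeasurableSpace Ω] {P : Measure Ω}
    [IsFiniteMeasure P] {s : ℕ → Set Ω} (h : Summable fun k => P.real (s k)) :
    ∀ᵐ x ∂P, ∀ᶠ k in atTop, x ∉ s k := by
  refine ae_eventually_notMem ?_
  have := h.tsum_ofReal_ne_top
  simpa [Measure.real, ENNReal.ofReal_toReal (measure_ne_top P _)] using this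

theorem RegularNormalizing.exists_doubling {d : ℕ} {γ : ℕ → ℝ} (hγ : RegularNormalizing d γ) :
    ∃ C : ℝ, 1 ≤ C ∧ ∀ n, 1 ≤ n → γ (2 * n) ≤ C * γ n := by
  obtain ⟨C, hC⟩ := hγ.doubling
  refine ⟨max C 1, le_max_right _ _, fun n hn => (hC n hn).trans ?_⟩
  exact mul_le_mul_of_nonneg_right (le_max_left _ _) (hγ.pos n hn).le

variable {μ : Measure ℝ} [IsProbabilityMeasure μ] {d : ℕ}

/-- If all `d` squares exceed `max g θ`, their product exceeds `θ ^ d = G`. -/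
theorem measureReal_pow_le_bigProb (hd : 1 ≤ d) {G g θ : ℝ} (hg : 0 < g) (hθ0 : 0 ≤ θ)
    (hθ : θ ^ d = G) : μ.real {y | max g θ < y ^ 2} ^ d ≤ bigProb μ G g (d - d) d := by
  have hm : MeasurableSet {y : ℝ | max g θ < y ^ 2} := measurableSet_lt measurable_const (by fun_prop)
  have h1 : (iidLaw (Fin d) μ).real
      (Set.pi (Finset.univ : Finset (Fin d)) fun _ => {y : ℝ | max g θ < y ^ 2}) =
      μ.real {y | max g θ < y ^ 2} ^ d := by
    rw [Measure.real, Measure.infinitePi_pi _ fun _ _ => hm]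
    simp [Measure.real]
  rw [← h1]
  refine measureReal_mono (fun x hx => ?_) (measure_ne_top _ _)
  have hx' : ∀ r, max g θ < x r ^ 2 := fun r => hx r (Finset.mem_coe.2 (Finset.mem_univ r))
  refine ⟨?_, fun r _ => (le_max_left _ _).trans_lt (hx' r)⟩
  have : Nonempty (Fin d) := ⟨⟨0, hd⟩⟩
  have h2 : (max g θ) ^ d < ∏ r, x r ^ 2 := by
    simpa using Finset.prod_lt_prod_of_nonempty (s := (Finset.univ : Finset (Fin d)))
      (f := fun _ => max g θ) (fun _ _ => lt_max_of_lt_left hg) (fun r _ => hx' r)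
      Finset.univ_nonempty
  simp only [Nat.sub_self, pow_zero, div_one]
  refine lt_of_le_of_lt ?_ h2
  rw [← hθ]
  exact pow_le_pow_left₀ hθ0 (le_max_right _ _) d

/-- Only (b) with `l = d` is used. Taking `d`-th roots of `G`, of the tail sums `R` and of their
geometric ratio reduces the claim to `eventually_level_le`; the root of the `l = d` term dominates
the single-variable tail. -/
theorem eventually_level_pow_le (hd : 1 ≤ d) {γ : ℕ → ℝ} (hγ : RegularNormalizing d γ)
    {g : ℕ → ℝ} {k₀ : ℕ}
    (hg : ∀ k, k₀ ≤ k → 0 < g k ∧ g k ≤ g (k + 1) ∧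
      (2 : ℝ) ^ k * ∫ y, min (y ^ 2 / g k) 1 ∂μ = 1)
    (hb : Summable fun k => (2 : ℝ) ^ (k * d) * bigProb μ (γ (2 ^ k) ^ 2) (g k) (d - d) d) :
    ∀ᶠ k in atTop, g k ^ d ≤ γ (2 ^ k) ^ 2 := by
  obtain ⟨R, ρ, C, hρ0, hρ, hC, hR0, hR⟩ := hγ.exists_geometric
  have hd0 : d ≠ 0 := by omega
  have hγ0 : ∀ k, 0 < γ (2 ^ k) := fun k => hγ.pos _ Nat.one_le_two_pow
  set G : ℕ → ℝ := fun k => γ (2 ^ k) ^ 2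
  have hG0 : ∀ k, 0 < G k := fun k => pow_pos (hγ0 k) 2
  set p : ℝ := (d : ℝ)⁻¹
  have hp : 0 < p := by positivity
  set θ : ℕ → ℝ := fun k => G k ^ p
  have hθ0 : ∀ k, 0 < θ k := fun k => Real.rpow_pos_of_pos (hG0 k) _
  have hθd : ∀ k, θ k ^ d = G k := fun k => Real.rpow_inv_natCast_pow (hG0 k).le hd0
  have hbθ : ∀ k, ((2 : ℝ) ^ (d * k) / G k) ^ p = (2 : ℝ) ^ k / θ k := fun k => by
    rw [Real.div_rpow (by positivity) (hG0 k).le, mul_comm d k, pow_mul,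
      Real.pow_rpow_inv_natCast (by positivity) hd0]
  have hlev : ∀ᶠ k in atTop, g k ≤ θ k := by
    refine eventually_level_le (μ := μ) (r := fun k => R k ^ p) (ρ := ρ ^ p) (K := C ^ p)
      (k₀ := max k₀ 1) (by positivity) (Real.rpow_lt_one hρ0 hρ hp)
      (fun k => Real.rpow_nonneg (hR0 k) _) (by positivity)
      (fun k hk => hg k (by omega)) (fun k hk => ⟨hθ0 k, ?_⟩) (fun k hk => ?_) ?_
    · refine Real.rpow_le_rpow (hG0 k).le ?_ hp.le
      exact pow_le_pow_left₀ (hγ0 k).le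
        (hγ.mono _ _ Nat.one_le_two_pow (Nat.pow_le_pow_right two_pos k.le_succ)) 2
    · obtain ⟨h1, h2, h3⟩ := hR k (by omega)
      refine ⟨?_, ?_, ?_⟩
      · rw [← Real.mul_rpow hρ0 (hR0 k)]
        exact Real.rpow_le_rpow (hR0 _) h1 hp.le
      · rw [← hbθ]
        exact Real.rpow_le_rpow (div_nonneg (by positivity) (hG0 k).le) h2 hp.le
      · rw [← hbθ, ← Real.mul_rpow hC.le (div_nonneg (by positivity) (hG0 k).le)]
        exact Real.rpow_le_rpow (hR0 _) h3 hp.le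
    · set s : ℕ → ℝ := fun k => (2 : ℝ) ^ k * μ.real {y | max (g k) (θ k) < y ^ 2}
      have hs0 : ∀ k, 0 ≤ s k := fun k => mul_nonneg (by positivity) measureReal_nonneg
      have hsd : Tendsto (fun k => s k ^ d) atTop (𝓝 0) := by
        refine squeeze_zero' (Eventually.of_forall fun k => pow_nonneg (hs0 k) d) ?_
          hb.tendsto_atTop_zero
        filter_upwards [eventually_ge_atTop k₀] with k hk
        simp only [s, mul_pow, ← pow_mul]
        exact mul_le_mul_of_nonneg_left (measureReal_pow_le_bigProb hd (hg k hk).1 (hθ0 k).le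
          (hθd k)) (by positivity)
      have := hsd.rpow_const (p := p) (Or.inr hp.le)
      rw [Real.zero_rpow hp.ne'] at this
      refine this.congr fun k => Real.pow_rpow_inv_natCast (hs0 k) hd0
  filter_upwards [hlev, eventually_ge_atTop k₀] with k hk hk₀
  exact (pow_le_pow_left₀ (hg k hk₀).1.le hk d).trans_eq (hθd k)

/-- With `R k` in place of the comparable weight `2 ^ (d k) / γ ^ 2`, the products `R k *
truncMoment` contract by `ρ` up to an error built from the terms of (b). -/
theorem summable_truncMoment {γ : ℕ → ℝ} (hγ : RegularNormalizing d γ)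
    {g : ℕ → ℝ} {k₀ : ℕ}
    (hg : ∀ k, k₀ ≤ k → 0 < g k ∧ g k ≤ g (k + 1) ∧
      (2 : ℝ) ^ k * ∫ y, min (y ^ 2 / g k) 1 ∂μ = 1)
    (hgG : ∀ k, k₀ ≤ k → g k ^ d ≤ γ (2 ^ k) ^ 2)
    (hb : ∀ l, 1 ≤ l → l ≤ d →
      Summable fun k => (2 : ℝ) ^ (k * l) * bigProb μ (γ (2 ^ k) ^ 2) (g k) (d - l) l) :
    Summable fun k =>
      (2 : ℝ) ^ (d * k) / γ (2 ^ k) ^ 2 * truncMoment μ (γ (2 ^ k) ^ 2) (g k) d := by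
  obtain ⟨R, ρ, C, hρ0, hρ, hC, hR0, hR⟩ := hγ.exists_geometric
  set G : ℕ → ℝ := fun k => γ (2 ^ k) ^ 2
  have hG0 : ∀ k, 0 < G k := fun k => pow_pos (hγ.pos _ Nat.one_le_two_pow) 2
  have hT0 : ∀ k, 0 ≤ truncMoment μ (G k) (g k) d := fun k => integral_nonneg fun x => sq_nonneg _
  have hbig0 : ∀ k m l, 0 ≤ bigProb μ (G k) (g k) m l := fun k m l => measureReal_nonneg
  set y : ℕ → ℝ := fun k => C * 2 ^ d * ∑ l ∈ Finset.Icc 1 d,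
    (d.choose l : ℝ) * ((2 : ℝ) ^ (k * l) * bigProb μ (G k) (g k) (d - l) l)
  have hysum : Summable y := (summable_sum fun l hl =>
    (hb l (Finset.mem_Icc.1 hl).1 (Finset.mem_Icc.1 hl).2).mul_left _).mul_left _
  have hH : Summable fun k => R k * truncMoment μ (G k) (g k) d := by
    refine summable_of_contraction (ρ := ρ) (y := y) (k₀ := max k₀ 1)
      (fun k => mul_nonneg (hR0 k) (hT0 k)) (fun k => ?_) hρ hysum fun k hk => ?_
    · exact mul_nonneg (by positivity) (Finset.sum_nonneg fun l _ =>
        mul_nonneg (by positivity) (mul_nonneg (by positivity) (hbig0 _ _ _)))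
    have hk0 : k₀ ≤ k := by omega
    obtain ⟨hgk, hgk', hone⟩ := hg k hk0
    have h1 := truncMoment_le (μ := μ) (d := d) hgk hgk' (hG0 k).le (hG0 (k + 1)).le
    have h2 := exceedMoment_le (μ := μ) (d := d) hgk (hgG k hk0)
    have hE : (2 : ℝ) ^ (d * k) * exceedMoment μ (G k) (g k) d ≤ ∑ l ∈ Finset.Icc 1 d,
        (d.choose l : ℝ) * ((2 : ℝ) ^ (k * l) * bigProb μ (G k) (g k) (d - l) l) := by
      refine (mul_le_mul_of_nonneg_left h2 (by positivity)).trans_eq ?_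
      rw [Finset.mul_sum]
      refine Finset.sum_congr rfl fun l hl => ?_
      have hl' := (Finset.mem_Icc.1 hl).2
      -- Of the `d` factors `2 ^ k`, `l` go with `bigProb` and the other `d - l` cancel the
      -- truncated moments.
      have e1 : (2 : ℝ) ^ (d * k) = 2 ^ (k * l) * (2 ^ k) ^ (d - l) := by
        rw [← pow_mul, ← pow_add, ← Nat.mul_add, mul_comm d k]
        congr 2; omega
      have e2 : ((2 : ℝ) ^ k) ^ (d - l) * (∫ y, min (y ^ 2 / g k) 1 ∂μ) ^ (d - l) = 1 := by
        rw [← mul_pow, hone, one_pow]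
      rw [e1]
      linear_combination (2 ^ (k * l) * (d.choose l : ℝ) * bigProb μ (G k) (g k) (d - l) l) * e2
    have hRG : R (k + 1) * G (k + 1) ≤ C * 2 ^ d * 2 ^ (d * k) := by
      have := mul_le_mul_of_nonneg_right (hR (k + 1) (by omega)).2.2 (hG0 (k + 1)).le
      refine this.trans_eq ?_
      have := (hG0 (k + 1)).ne'
      rw [Nat.mul_add, mul_one, pow_add]
      field_simp
      exact div_self this
    have hE0 : 0 ≤ exceedMoment μ (G k) (g k) d := integral_nonneg fun x => by
      dsimp only
      split_ifs
      · exact (prod_min_mem_Icc hgk _ x).1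
      · exact le_rfl
    calc R (k + 1) * truncMoment μ (G (k + 1)) (g (k + 1)) d
        ≤ R (k + 1) * (truncMoment μ (G k) (g k) d + G (k + 1) * exceedMoment μ (G k) (g k) d) :=
          mul_le_mul_of_nonneg_left h1 (hR0 _)
      _ = R (k + 1) * truncMoment μ (G k) (g k) d +
          R (k + 1) * G (k + 1) * exceedMoment μ (G k) (g k) d := by ring
      _ ≤ ρ * R k * truncMoment μ (G k) (g k) d +
          C * 2 ^ d * 2 ^ (d * k) * exceedMoment μ (G k) (g k) d :=
          add_le_add (mul_le_mul_of_nonneg_right (hR k (by omega)).1 (hT0 k))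
            (mul_le_mul_of_nonneg_right hRG hE0)
      _ ≤ ρ * (R k * truncMoment μ (G k) (g k) d) + y k := by
          rw [mul_assoc ρ, mul_assoc (C * 2 ^ d)]
          exact add_le_add le_rfl (mul_le_mul_of_nonneg_left hE (by positivity))
  refine Summable.of_norm_bounded_eventually_nat hH ?_
  filter_upwards [eventually_ge_atTop 1] with k hk
  rw [Real.norm_of_nonneg (mul_nonneg (div_nonneg (by positivity) (hG0 k).le) (hT0 k))]
  exact mul_le_mul_of_nonneg_right (hR k hk).2.1 (hT0 k)

/-- The tail bound for the maximal product sum: exceedances plus a second moment. -/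
theorem measureReal_max_prodSum_le (hμ : MeasurePreserving (fun x : ℝ => -x) μ μ) {G g : ℝ}
    (hg : 0 < g) (hgG : g ^ d ≤ G) (N : ℕ) {t : ℝ} (ht : 0 < t) :
    (iidLaw ℕ μ).real {x | ∃ n ≤ N, t ≤ |kernelSum (fun I x => ∏ i ∈ I, x i) d n x|} ≤
      ∑ l ∈ Finset.Icc 1 d, (N : ℝ) ^ l * bigProb μ G g (d - l) l +
        (N : ℝ) ^ d * truncMoment μ G g d / t ^ 2 := by
  have hG : 0 ≤ G := (pow_pos hg d).le.trans hgG
  have hψ := oddKernel_truncKernel hG g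
  have h1 := hψ.maximal_inequality (d := d) hμ N ht
  rw [hψ.integral_kernelSum_sq hμ, Finset.sum_congr rfl fun I hI => by
    rw [integral_truncKernel_sq, (Finset.mem_powersetCard.1 hI).2], Finset.sum_const,
    nsmul_eq_mul] at h1
  have hT0 : 0 ≤ truncMoment μ G g d := integral_nonneg fun x => sq_nonneg _
  have h2 : (iidLaw ℕ μ).real {x | ∃ n ≤ N, t ≤ |kernelSum (truncKernel G g) d n x|} ≤
      (N : ℝ) ^ d * truncMoment μ G g d / t ^ 2 := by
    rw [le_div_iff₀ (pow_pos ht 2), mul_comm]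
    exact h1.trans (mul_le_mul_of_nonneg_right (card_powersetCard_range_le d N) hT0)
  -- When no kernel over `range N` is cut, the truncated and the original sums agree for every `n ≤
  -- N`.
  have hsub : {x | ∃ n ≤ N, t ≤ |kernelSum (fun I x => ∏ i ∈ I, x i) d n x|} ⊆
      {x | ∃ I ∈ (Finset.range N).powersetCard d, G < ∏ i ∈ I, max (x i ^ 2) g} ∪
        {x | ∃ n ≤ N, t ≤ |kernelSum (truncKernel G g) d n x|} := by
    rintro x ⟨n, hn, hx⟩
    by_cases hex : ∃ I ∈ (Finset.range N).powersetCard d, G < ∏ i ∈ I, max (x i ^ 2) g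
    · exact Or.inl hex
    · refine Or.inr ⟨n, hn, ?_⟩
      push Not at hex
      convert hx using 2
      refine Finset.sum_congr rfl fun I hI => if_neg (not_lt.2 (hex I ?_))
      exact Finset.powersetCard_mono (Finset.range_mono hn) hI
  exact (measureReal_mono hsub (measure_ne_top _ _)).trans ((measureReal_union_le _ _).trans
    (add_le_add (measureReal_exists_exceedance_le hg hgG N) h2))

/-- For `2 ^ j ≤ n < 2 ^ (j + 1)`, monotonicity and doubling give `γ (2 ^ (j + 1)) ≤ C γ n`, so
control on dyadic blocks suffices. -/
theorem tendsto_of_forall_dyadic {γ : ℕ → ℝ} (hγ : RegularNormalizing d γ) {a : ℕ → ℝ}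
    (h : ∀ m : ℕ, ∀ᶠ k in atTop, ∀ n ≤ 2 ^ k, |a n| < 1 / ((m : ℝ) + 1) * γ (2 ^ k)) :
    Tendsto (fun n => (γ n)⁻¹ * a n) atTop (𝓝 0) := by
  obtain ⟨C, hC1, hC⟩ := hγ.exists_doubling
  have hC0 : 0 < C := by linarith
  rw [Metric.tendsto_atTop]
  intro ε hε
  obtain ⟨m, hm⟩ := exists_nat_one_div_lt (div_pos hε hC0)
  obtain ⟨k₀, hk₀⟩ := eventually_atTop.1 (h m)
  refine ⟨2 ^ k₀, fun n hn => ?_⟩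
  have hn0 : n ≠ 0 := (lt_of_lt_of_le (by positivity) hn).ne'
  have hlog : k₀ ≤ Nat.log 2 n := Nat.le_log_of_pow_le one_lt_two hn
  have h1 := hk₀ (Nat.log 2 n + 1) (by omega) n (Nat.lt_pow_succ_log_self one_lt_two n).le
  have hγn := hγ.pos n (Nat.one_le_iff_ne_zero.2 hn0)
  have h2 : γ (2 ^ (Nat.log 2 n + 1)) ≤ C * γ n := by
    rw [pow_succ']
    exact (hC _ Nat.one_le_two_pow).trans (mul_le_mul_of_nonneg_left
      (hγ.mono _ _ Nat.one_le_two_pow (Nat.pow_log_le_self 2 hn0)) hC0.le)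
  rw [Real.dist_eq, sub_zero, abs_mul, abs_of_pos (inv_pos.2 hγn), inv_mul_lt_iff₀ hγn]
  calc |a n| < 1 / ((m : ℝ) + 1) * γ (2 ^ (Nat.log 2 n + 1)) := h1
    _ ≤ ε / C * (C * γ n) := mul_le_mul hm.le h2 (hγ.pos _ Nat.one_le_two_pow).le (by positivity)
    _ = γ n * ε := by field_simp

theorem tendsto_prodSum_of_summable (hd : 1 ≤ d)
    (hμ : MeasurePreserving (fun x : ℝ => -x) μ μ) (hnz : μ.real {0}ᶜ ≠ 0) {γ : ℕ → ℝ}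
    (hγ : RegularNormalizing d γ)
    (hb : ∀ l, 1 ≤ l → l ≤ d → Summable fun k => (2 : ℝ) ^ (k * l) *
      bigProb μ (γ (2 ^ k) ^ 2) (truncLevel μ id (2 ^ k) ^ 2) (d - l) l) :
    ∀ᵐ x ∂(iidLaw ℕ μ), Tendsto
      (fun n => (γ n)⁻¹ * kernelSum (fun I x => ∏ i ∈ I, x i) d n x) atTop (𝓝 0) := by
  set g : ℕ → ℝ := fun k => truncLevel μ id (2 ^ k) ^ 2
  obtain ⟨k₁, hk₁⟩ := eventually_atTop.1 (eventually_one_lt_mul_measure hnz)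
  have hg : ∀ k, k₁ ≤ k → 0 < g k ∧ g k ≤ g (k + 1) ∧
      (2 : ℝ) ^ k * ∫ y, min (y ^ 2 / g k) 1 ∂μ = 1 := fun k hk => by
    have hpos := truncLevel_pos (hk₁ k hk)
    refine ⟨pow_pos hpos 2, pow_le_pow_left₀ hpos.le (truncLevel_mono
      (Nat.pow_le_pow_right two_pos k.le_succ)) 2, ?_⟩
    exact_mod_cast truncLevel_eq_one (hk₁ k hk)
  obtain ⟨k₂, hk₂⟩ := eventually_atTop.1 (eventually_level_pow_le hd hγ hg (hb d hd le_rfl))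
  have hmom := summable_truncMoment hγ (k₀ := max k₁ k₂) (fun k hk => hg k (by omega))
    (fun k hk => hk₂ k (by omega)) hb
  have hmain : ∀ m : ℕ, ∀ᵐ x ∂(iidLaw ℕ μ), ∀ᶠ k in atTop,
      x ∉ {x | ∃ n ≤ 2 ^ k, 1 / ((m : ℝ) + 1) * γ (2 ^ k) ≤
        |kernelSum (fun I x => ∏ i ∈ I, x i) d n x|} := fun m => by
    refine ae_eventually_notMem_of_summable (Summable.of_norm_bounded_eventually_nat
      ((summable_sum fun l hl => hb l (Finset.mem_Icc.1 hl).1 (Finset.mem_Icc.1 hl).2).add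
        (hmom.mul_left (((m : ℝ) + 1) ^ 2))) ?_)
    filter_upwards [eventually_ge_atTop (max k₁ k₂)] with k hk
    have hγk := hγ.pos (2 ^ k) Nat.one_le_two_pow
    have hm0 : (0 : ℝ) < (m : ℝ) + 1 := by positivity
    rw [Real.norm_of_nonneg measureReal_nonneg]
    refine (measureReal_max_prodSum_le hμ (hg k (by omega)).1 (hk₂ k (by omega)) (2 ^ k)
      (t := 1 / ((m : ℝ) + 1) * γ (2 ^ k)) (by positivity)).trans_eq ?_
    congr 1
    · refine Finset.sum_congr rfl fun l _ => ?_
      push_cast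
      rw [pow_mul]
    · push_cast
      rw [← pow_mul, mul_comm k d]
      field_simp
  filter_upwards [ae_all_iff.2 hmain] with x hx
  refine tendsto_of_forall_dyadic hγ fun m => (hx m).mono fun k hk n hn => ?_
  by_contra hlt
  exact hk ⟨n, hn, not_lt.1 hlt⟩

end Sufficiency

/-! ### Lower bounds for sums of symmetric variables. -/

section Rows

variable {μ : Measure ℝ} [IsProbabilityMeasure μ]

/-- The form of the reflection principle used below: on `A`, either the point or its reflection lies
in `B`. -/
theorem measureReal_le_two_mul_of_subset {Ω : Type*} [MeasurableSpace Ω] {P : Measure Ω}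
    [IsFiniteMeasure P] {T : Ω → Ω} (hT : MeasurePreserving T P P) {A B : Set Ω}
    (hB : MeasurableSet B) (h : A ⊆ B ∪ T ⁻¹' B) : P.real A ≤ 2 * P.real B := by
  calc P.real A ≤ P.real (B ∪ T ⁻¹' B) := measureReal_mono h (measure_ne_top _ _)
    _ ≤ P.real B + P.real (T ⁻¹' B) := measureReal_union_le _ _
    _ = 2 * P.real B := by rw [hT.measureReal_preimage hB.nullMeasurableSet]; ring

theorem measurable_sum_range (N : ℕ) : Measurable fun x : ℕ → ℝ => ∑ i ∈ Finset.range N, x i := by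
  fun_prop

/-- Combine `(1 - q) ^ N ≤ 1 / (1 + N q)` with `1 / (1 + u) ≤ 1 - u / 2` for `0 ≤ u ≤ 1`. -/
theorem half_mul_le_one_sub_pow {q : ℝ} (hq0 : 0 ≤ q) (N : ℕ) (hNq : N * q ≤ 1) (hq1 : q ≤ 1) :
    N * q / 2 ≤ 1 - (1 - q) ^ N := by
  have h1 : 1 + N * q ≤ (1 + q) ^ N := one_add_mul_le_pow (by linarith) N
  have h2 : (1 - q) ^ N * (1 + q) ^ N ≤ 1 := by
    rw [← mul_pow]
    exact pow_le_one₀ (mul_nonneg (by linarith) (by linarith)) (by nlinarith)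
  have h3 : 0 ≤ (1 - q) ^ N := pow_nonneg (by linarith) N
  have h4 : (1 - q) ^ N * (1 + N * q) ≤ 1 := (mul_le_mul_of_nonneg_left h1 h3).trans h2
  have h5 : 0 ≤ N * q := by positivity
  nlinarith

/-- A sum of symmetric variables is as large as its largest term, up to constants. -/
theorem mul_measureReal_le_sum (hμ : MeasurePreserving (fun x : ℝ => -x) μ μ) (N : ℕ) {t : ℝ}
    (ht : N * μ.real {y | t < |y|} ≤ 1) :
    N * μ.real {y | t < |y|} ≤
      4 * (iidLaw ℕ μ).real {x | t < |∑ i ∈ Finset.range N, x i|} := by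
  set q := μ.real {y | t < |y|} with hq
  have hmt : MeasurableSet {y : ℝ | t < |y|} := measurableSet_lt measurable_const (by fun_prop)
  have hmi : ∀ i, Measurable fun x : ℕ → ℝ => |x i| := fun i => (measurable_pi_apply i).abs
  -- `B i` says that `i` is the first index with `|x i| > t`; these events are disjoint.
  let B : ℕ → Set (ℕ → ℝ) := fun i => {x | t < |x i| ∧ ∀ j < i, |x j| ≤ t}
  let S : Set (ℕ → ℝ) := {x | t < |∑ i ∈ Finset.range N, x i|}
  have hS : MeasurableSet S := measurableSet_lt measurable_const (measurable_sum_range N).abs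
  have hB : ∀ i, MeasurableSet (B i) := fun i => by
    refine (measurableSet_lt measurable_const (hmi i)).inter ?_
    have : {x : ℕ → ℝ | ∀ j < i, |x j| ≤ t} = ⋂ j ∈ Finset.range i, {x | |x j| ≤ t} := by
      ext; simp
    change MeasurableSet {x : ℕ → ℝ | ∀ j < i, |x j| ≤ t}
    rw [this]
    exact Finset.measurableSet_biInter _ fun j _ => measurableSet_le (hmi j) measurable_const
  have hBS : ∀ i < N, (iidLaw ℕ μ).real (B i) ≤ 2 * (iidLaw ℕ μ).real (B i ∩ S) := by
    intro i hi
    -- Flipping every term except the `i`-th preserves `B i`. The two sums add up to `2 * x i`, so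
    -- one of them exceeds `t` in absolute value.
    refine measureReal_le_two_mul_of_subset
      (measurePreserving_signFlip hμ ((Finset.range N).erase i)) ((hB i).inter hS) fun x hx => ?_
    have habs : ∀ j, |signFlip ((Finset.range N).erase i) x j| = |x j| := fun j => by
      unfold signFlip; split_ifs <;> simp
    have hx' : signFlip ((Finset.range N).erase i) x ∈ B i := by
      simpa only [B, Set.mem_ofPred_eq, habs] using hx
    have e1 : ∑ j ∈ Finset.range N, x j = x i + ∑ j ∈ (Finset.range N).erase i, x j :=
      (Finset.add_sum_erase _ _ (Finset.mem_range.2 hi)).symm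
    have e2 : ∑ j ∈ Finset.range N, signFlip ((Finset.range N).erase i) x j =
        x i - ∑ j ∈ (Finset.range N).erase i, x j := by
      rw [← Finset.add_sum_erase _ _ (Finset.mem_range.2 hi), sub_eq_add_neg,
        ← Finset.sum_neg_distrib]
      congr 1
      · simp [signFlip]
      · exact Finset.sum_congr rfl fun j hj => by simp [signFlip, hj]
    by_contra hcon
    simp only [Set.mem_union, Set.mem_inter_iff, Set.mem_preimage, hx, hx', true_and, S,
      Set.mem_ofPred_eq, e1, e2, not_or, not_lt] at hcon
    have h3 := abs_add_le (x i + ∑ j ∈ (Finset.range N).erase i, x j)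
      (x i - ∑ j ∈ (Finset.range N).erase i, x j)
    rw [show x i + ∑ j ∈ (Finset.range N).erase i, x j +
      (x i - ∑ j ∈ (Finset.range N).erase i, x j) = 2 * x i by ring, abs_mul, abs_two] at h3
    linarith [hx.1, hcon.1, hcon.2]
  have hpd : Set.PairwiseDisjoint (Finset.range N : Set ℕ) fun i => B i ∩ S := by
    have : ∀ i j, i < j → Disjoint (B i ∩ S) (B j ∩ S) := fun i j hij =>
      Set.disjoint_left.2 fun x hi hj => absurd (hj.1.2 i hij) (not_le.2 hi.1.1)
    intro i _ j _ hij
    rcases lt_or_gt_of_ne hij with h | h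
    · exact this i j h
    · exact (this j i h).symm
  have hbox : (iidLaw ℕ μ).real (Set.pi (Finset.range N) fun _ => {y : ℝ | t < |y|}ᶜ) =
      (1 - q) ^ N := by
    rw [Measure.real, Measure.infinitePi_pi _ fun _ _ => hmt.compl]
    simp only [Finset.prod_const, Finset.card_range, ENNReal.toReal_pow]
    rw [← Measure.real, probReal_compl_eq_one_sub hmt]
  have hboxm : MeasurableSet (Set.pi (Finset.range N : Set ℕ) fun _ => {y : ℝ | t < |y|}ᶜ) :=
    MeasurableSet.pi (Finset.countable_toSet _) fun _ _ => hmt.compl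
  have hcover : (Set.pi (Finset.range N : Set ℕ) fun _ => {y : ℝ | t < |y|}ᶜ)ᶜ ⊆
      ⋃ i ∈ Finset.range N, B i := fun x hx => by
    classical
    have hex : ∃ i, i < N ∧ t < |x i| := by
      by_contra hno
      push Not at hno
      exact hx fun i hi => not_lt.2 (hno i (by simpa using hi))
    refine Set.mem_iUnion₂.2 ⟨Nat.find hex, Finset.mem_range.2 (Nat.find_spec hex).1,
      (Nat.find_spec hex).2, fun j hj => ?_⟩
    have := Nat.find_min hex hj
    by_contra hlt
    exact this ⟨hj.trans (Nat.find_spec hex).1, not_le.1 hlt⟩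
  have h1 : 1 - (1 - q) ^ N ≤ ∑ i ∈ Finset.range N, (iidLaw ℕ μ).real (B i) := by
    rw [← hbox, ← probReal_compl_eq_one_sub hboxm]
    exact (measureReal_mono hcover (measure_ne_top _ _)).trans (measureReal_biUnion_finset_le _ _)
  have h2 : ∑ i ∈ Finset.range N, (iidLaw ℕ μ).real (B i ∩ S) ≤ (iidLaw ℕ μ).real S := by
    rw [← measureReal_biUnion_finset hpd fun i _ => (hB i).inter hS]
    exact measureReal_mono (Set.iUnion₂_subset fun i _ => Set.inter_subset_right)
      (measure_ne_top _ _)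
  have h3 : ∑ i ∈ Finset.range N, (iidLaw ℕ μ).real (B i) ≤
      2 * ∑ i ∈ Finset.range N, (iidLaw ℕ μ).real (B i ∩ S) := by
    rw [Finset.mul_sum]
    exact Finset.sum_le_sum fun i hi => hBS i (Finset.mem_range.1 hi)
  have h4 := half_mul_le_one_sub_pow (q := q) measureReal_nonneg N ht measureReal_le_one
  linarith

section Moments

variable {f : ℝ → ℝ} {B : ℝ}

theorem integral_comp_eval (hf : Measurable f) (n : ℕ) :
    ∫ x : ℕ → ℝ, f (x n) ∂(iidLaw ℕ μ) = ∫ y, f y ∂μ := by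
  conv_rhs => rw [← Measure.infinitePi_map_eval (fun _ : ℕ => μ) n]
  rw [integral_map (measurable_pi_apply n).aemeasurable hf.aestronglyMeasurable]

theorem abs_sum_comp_le (hB : ∀ y, |f y| ≤ B) (n : ℕ) (x : ℕ → ℝ) :
    |∑ i ∈ Finset.range n, f (x i)| ≤ n * B := by
  refine (Finset.abs_sum_le_sum_abs _ _).trans ?_
  simpa using Finset.sum_le_card_nsmul (Finset.range n) _ B fun i _ => hB (x i)

theorem integral_sum_pow_mul (hf : Measurable f) (n a b : ℕ) :
    ∫ x : ℕ → ℝ, (∑ i ∈ Finset.range n, f (x i)) ^ a * f (x n) ^ b ∂(iidLaw ℕ μ) =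
      (∫ x : ℕ → ℝ, (∑ i ∈ Finset.range n, f (x i)) ^ a ∂(iidLaw ℕ μ)) * ∫ y, f y ^ b ∂μ := by
  rw [integral_mul_of_dependsOn (f := fun x : ℕ → ℝ => (∑ i ∈ Finset.range n, f (x i)) ^ a)
    (g := fun x => f (x n) ^ b) (by fun_prop) (by fun_prop) (s := Finset.range n) (t := {n})
    (by simp), integral_comp_eval (hf.pow_const b)]
  · intro x y h
    have : ∑ i ∈ Finset.range n, f (x i) = ∑ i ∈ Finset.range n, f (y i) :=
      Finset.sum_congr rfl fun i hi => by rw [h i hi]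
    simp only [this]
  · intro x y h
    simp only [h n (by simp)]

theorem integrable_sum_pow_mul (hf : Measurable f) (hB : ∀ y, |f y| ≤ B) (n a b : ℕ) :
    Integrable (fun x : ℕ → ℝ => (∑ i ∈ Finset.range n, f (x i)) ^ a * f (x n) ^ b)
      (iidLaw ℕ μ) := by
  refine integrable_of_abs_le (by fun_prop) (B := (n * B) ^ a * B ^ b) fun x => ?_
  rw [abs_mul, abs_pow, abs_pow]
  have hB0 : 0 ≤ B := (abs_nonneg _).trans (hB 0)
  exact mul_le_mul (pow_le_pow_left₀ (abs_nonneg _) (abs_sum_comp_le hB n x) a)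
    (pow_le_pow_left₀ (abs_nonneg _) (hB _) b) (by positivity) (by positivity)

theorem integral_odd_pow {ν : Measure ℝ} (hν : MeasurePreserving (fun x : ℝ => -x) ν ν) (hf : Measurable f)
    (hodd : ∀ y, f (-y) = -f y) {b : ℕ} (hb : Odd b) : ∫ y, f y ^ b ∂ν = 0 :=
  integral_eq_zero_of_odd hν (hf.pow_const b) fun y => by rw [hodd, hb.neg_pow]

theorem integral_sum_sq (hμ : MeasurePreserving (fun x : ℝ => -x) μ μ) (hf : Measurable f)
    (hodd : ∀ y, f (-y) = -f y) (hB : ∀ y, |f y| ≤ B) (n : ℕ) :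
    ∫ x : ℕ → ℝ, (∑ i ∈ Finset.range n, f (x i)) ^ 2 ∂(iidLaw ℕ μ) = n * ∫ y, f y ^ 2 ∂μ := by
  induction n with
  | zero => simp
  | succ n ih =>
    -- The powers `0` and `1` are kept explicit so that `integral_sum_pow_mul` applies to every
    -- term.
    have e : ∀ x : ℕ → ℝ, (∑ i ∈ Finset.range (n + 1), f (x i)) ^ 2 =
        (∑ i ∈ Finset.range n, f (x i)) ^ 2 * f (x n) ^ 0 +
        2 * ((∑ i ∈ Finset.range n, f (x i)) ^ 1 * f (x n) ^ 1) +
        (∑ i ∈ Finset.range n, f (x i)) ^ 0 * f (x n) ^ 2 := fun x => by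
      rw [Finset.sum_range_succ]; ring
    have hi := integrable_sum_pow_mul (μ := μ) hf hB n
    simp only [e]
    rw [integral_add ((hi 2 0).fun_add ((hi 1 1).const_mul 2)) (hi 0 2),
      integral_add (hi 2 0) ((hi 1 1).const_mul 2), integral_const_mul,
      integral_sum_pow_mul hf, integral_sum_pow_mul hf, integral_sum_pow_mul hf, ih,
      integral_odd_pow hμ hf hodd odd_one]
    simp
    ring

/-- Odd moments vanish, so adding a term contributes `6 n s ^ 2` plus a fourth moment, where `s` is
the second moment; `3 (n + 1) ^ 2 - 3 n ^ 2` is at least `6 n`. -/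
theorem integral_sum_pow_four_le (hμ : MeasurePreserving (fun x : ℝ => -x) μ μ)
    (hf : Measurable f) (hodd : ∀ y, f (-y) = -f y) (hB : ∀ y, |f y| ≤ B) (n : ℕ) :
    ∫ x : ℕ → ℝ, (∑ i ∈ Finset.range n, f (x i)) ^ 4 ∂(iidLaw ℕ μ) ≤
      3 * (n * ∫ y, f y ^ 2 ∂μ) ^ 2 + n * ∫ y, f y ^ 4 ∂μ := by
  induction n with
  | zero => simp
  | succ n ih =>
    have e : ∀ x : ℕ → ℝ, (∑ i ∈ Finset.range (n + 1), f (x i)) ^ 4 =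
        (∑ i ∈ Finset.range n, f (x i)) ^ 4 * f (x n) ^ 0 +
        4 * ((∑ i ∈ Finset.range n, f (x i)) ^ 3 * f (x n) ^ 1) +
        6 * ((∑ i ∈ Finset.range n, f (x i)) ^ 2 * f (x n) ^ 2) +
        4 * ((∑ i ∈ Finset.range n, f (x i)) ^ 1 * f (x n) ^ 3) +
        (∑ i ∈ Finset.range n, f (x i)) ^ 0 * f (x n) ^ 4 := fun x => by
      rw [Finset.sum_range_succ]; ring
    have hi := integrable_sum_pow_mul (μ := μ) hf hB n
    simp only [e]
    rw [integral_add ((((hi 4 0).fun_add ((hi 3 1).const_mul 4)).fun_add ((hi 2 2).const_mul 6)).fun_add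
        ((hi 1 3).const_mul 4)) (hi 0 4),
      integral_add (((hi 4 0).fun_add ((hi 3 1).const_mul 4)).fun_add ((hi 2 2).const_mul 6))
        ((hi 1 3).const_mul 4),
      integral_add ((hi 4 0).fun_add ((hi 3 1).const_mul 4)) ((hi 2 2).const_mul 6),
      integral_add (hi 4 0) ((hi 3 1).const_mul 4), integral_const_mul, integral_const_mul,
      integral_const_mul, integral_sum_pow_mul hf, integral_sum_pow_mul hf,
      integral_sum_pow_mul hf, integral_sum_pow_mul hf, integral_sum_pow_mul hf,
      integral_odd_pow hμ hf hodd odd_one, integral_odd_pow hμ hf hodd (b := 3) (by decide),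
      integral_sum_sq hμ hf hodd hB]
    simp only [pow_zero, integral_const, probReal_univ, smul_eq_mul, mul_one, mul_zero, add_zero,
      one_mul]
    push_cast
    nlinarith [sq_nonneg (∫ y, f y ^ 2 ∂μ)]

/-- A Paley–Zygmund bound for sums of bounded symmetric variables. -/
theorem one_tenth_le_measureReal (hμ : MeasurePreserving (fun x : ℝ => -x) μ μ)
    (hf : Measurable f) (hodd : ∀ y, f (-y) = -f y) (hB : ∀ y, |f y| ≤ B) (n : ℕ)
    (hpos : 0 < n * ∫ y, f y ^ 2 ∂μ) (hB2 : B ^ 2 ≤ 2 * (n * ∫ y, f y ^ 2 ∂μ)) :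
    1 / 10 ≤ (iidLaw ℕ μ).real
      {x | (n * ∫ y, f y ^ 2 ∂μ) / 4 < (∑ i ∈ Finset.range n, f (x i)) ^ 2} := by
  set v := n * ∫ y, f y ^ 2 ∂μ with hv
  let A : (ℕ → ℝ) → ℝ := fun x => ∑ i ∈ Finset.range n, f (x i)
  have hA : Measurable A := by fun_prop
  set E := {x | v / 4 < A x ^ 2} with hE
  have hEm : MeasurableSet E := measurableSet_lt measurable_const (hA.pow_const 2)
  -- The bound `3 v ^ 2 + B ^ 2 v` together with `B ^ 2 ≤ 2 v`.
  have h4 : ∫ x, A x ^ 4 ∂(iidLaw ℕ μ) ≤ 5 * v ^ 2 := by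
    refine (integral_sum_pow_four_le hμ hf hodd hB n).trans ?_
    have hw : ∫ y, f y ^ 4 ∂μ ≤ B ^ 2 * ∫ y, f y ^ 2 ∂μ := by
      rw [← integral_const_mul]
      have hsq : ∀ y, f y ^ 2 ≤ B ^ 2 := fun y => by
        rw [← sq_abs (f y)]; exact pow_le_pow_left₀ (abs_nonneg _) (hB y) 2
      refine integral_mono ?_ ?_ fun y => ?_
      · exact integrable_of_abs_le (hf.pow_const 4) (B := B ^ 4) fun y => by
          rw [abs_pow]; exact pow_le_pow_left₀ (abs_nonneg _) (hB y) 4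
      · exact (integrable_of_abs_le (hf.pow_const 2) (B := B ^ 2) fun y => by
          rw [abs_pow]; exact pow_le_pow_left₀ (abs_nonneg _) (hB y) 2).const_mul _
      · have := mul_le_mul_of_nonneg_right (hsq y) (sq_nonneg (f y))
        calc f y ^ 4 = f y ^ 2 * f y ^ 2 := by ring
          _ ≤ _ := this
    have h1 : n * ∫ y, f y ^ 4 ∂μ ≤ B ^ 2 * v :=
      (mul_le_mul_of_nonneg_left hw n.cast_nonneg).trans_eq (by rw [hv]; ring)
    nlinarith
  have hAb : ∀ x, |A x| ≤ n * B := fun x => abs_sum_comp_le hB n x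
  have hi : ∀ a : ℕ, Integrable (fun x => A x ^ a) (iidLaw ℕ μ) := fun a =>
    integrable_of_abs_le (hA.pow_const a) (B := (n * B) ^ a) fun x => by
      rw [abs_pow]; exact pow_le_pow_left₀ (abs_nonneg _) (hAb x) a
  have hiE : Integrable (E.indicator fun _ => 5 * v) (iidLaw ℕ μ) :=
    (integrable_const _).indicator hEm
  -- On `E` this is `(A ^ 2 - 10 v) ^ 2 ≥ 0`. After integration the first two terms give at most `v
  -- / 2`, leaving `v / 2 ≤ 5 v P(E)`.
  have hpt : ∀ x, A x ^ 2 ≤ v / 4 + (20 * v)⁻¹ * A x ^ 4 + E.indicator (fun _ => 5 * v) x := by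
    intro x
    have hnn : 0 ≤ (20 * v)⁻¹ * A x ^ 4 := by positivity
    by_cases hx : x ∈ E
    · rw [Set.indicator_of_mem hx]
      have hkey : A x ^ 2 ≤ (20 * v)⁻¹ * A x ^ 4 + 5 * v := by
        have : (20 * v)⁻¹ * A x ^ 4 + 5 * v - A x ^ 2 = (20 * v)⁻¹ * (A x ^ 2 - 10 * v) ^ 2 := by
          field_simp; ring
        have h0 : 0 ≤ (20 * v)⁻¹ * (A x ^ 2 - 10 * v) ^ 2 := by positivity
        linarith
      linarith
    · rw [Set.indicator_of_notMem hx]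
      have : A x ^ 2 ≤ v / 4 := not_lt.1 hx
      linarith
  have hint := integral_mono (hi 2) (((integrable_const (v / 4)).fun_add
    ((hi 4).const_mul _)).fun_add hiE) hpt
  rw [integral_add ((integrable_const (v / 4)).fun_add ((hi 4).const_mul _)) hiE,
    integral_add (integrable_const _) ((hi 4).const_mul _), integral_const_mul,
    integral_sum_sq hμ hf hodd hB, integral_indicator hEm] at hint
  simp only [integral_const, probReal_univ, smul_eq_mul, one_mul, measureReal_restrict_apply_univ]
    at hint
  have h5 : (20 * v)⁻¹ * ∫ x, A x ^ 4 ∂(iidLaw ℕ μ) ≤ v / 4 := by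
    refine (mul_le_mul_of_nonneg_left h4 (by positivity)).trans_eq ?_
    field_simp
    norm_num
  have h6 : v * (1 / 10) ≤ v * (iidLaw ℕ μ).real E := by
    rw [← hv] at hint
    linarith
  exact le_of_mul_le_mul_left h6 hpos

end Moments

/-- Averaging a variable with this reflection yields its truncation at `c`; this transfers lower
bounds from truncated sums to full sums. -/
theorem measurePreserving_neg_off {ν : Measure ℝ} (hν : MeasurePreserving (fun x : ℝ => -x) ν ν) (c : ℝ) :
    MeasurePreserving (fun y : ℝ => if |y| ≤ c then y else -y) ν ν := by
  have hm : MeasurableSet {y : ℝ | |y| ≤ c} := measurableSet_le (by fun_prop) measurable_const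
  have hT : Measurable fun y : ℝ => if |y| ≤ c then y else -y :=
    Measurable.ite hm measurable_id measurable_neg
  refine ⟨hT, Measure.ext fun s hs => ?_⟩
  rw [Measure.map_apply hT hs, ← measure_inter_add_sdiff _ hm, ← measure_inter_add_sdiff s hm]
  congr 1
  · congr 1
    ext y
    simp only [Set.mem_inter_iff, Set.mem_preimage, Set.mem_ofPred_eq]
    exact and_congr_left fun h => by rw [if_pos h]
  · rw [← hν.measure_preimage (hs.diff hm).nullMeasurableSet]
    congr 1
    ext y
    simp only [Set.mem_sdiff, Set.mem_preimage, Set.mem_ofPred_eq, abs_neg]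
    exact and_congr_left fun h => by rw [if_neg h]

/-- Half of the unit mass of `N * min (y ^ 2 / c ^ 2) 1` comes either from `|y| > c`, where a single
large term suffices, or from `|y| ≤ c`, where Paley–Zygmund applies to the truncated variables. -/
theorem one_twentieth_le_measureReal_sum (hμ : MeasurePreserving (fun x : ℝ => -x) μ μ) {c : ℝ}
    (hc : 0 < c) (N : ℕ) (h1 : N * ∫ y, min (y ^ 2 / c ^ 2) 1 ∂μ = 1) :
    N * μ.real {y | c < |y|} ≤ 1 ∧
      1 / 20 ≤ (iidLaw ℕ μ).real {x | c / 3 ≤ |∑ i ∈ Finset.range N, x i|} := by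
  have hmc : MeasurableSet {y : ℝ | c < |y|} := measurableSet_lt measurable_const (by fun_prop)
  have hI1 : Integrable ({y : ℝ | c < |y|}.indicator fun _ => (1 : ℝ)) μ :=
    (integrable_const 1).indicator hmc
  have hI1' : ∫ y, {y : ℝ | c < |y|}.indicator (fun _ => (1 : ℝ)) y ∂μ = μ.real {y | c < |y|} := by
    rw [integral_indicator hmc]; simp
  have hle : N * μ.real {y | c < |y|} ≤ 1 := by
    rw [← h1, ← hI1']
    refine mul_le_mul_of_nonneg_left (integral_mono hI1 (integrable_min_sq_div c) fun y => ?_)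
      N.cast_nonneg
    by_cases hy : c < |y|
    · simp only [Set.indicator_of_mem (show y ∈ {y : ℝ | c < |y|} from hy)]
      refine le_min ?_ le_rfl
      rw [one_le_div (pow_pos hc 2), ← sq_abs y]
      exact pow_le_pow_left₀ hc.le hy.le 2
    · simp only [Set.indicator_of_notMem (show y ∉ {y : ℝ | c < |y|} from hy)]
      exact le_min (by positivity) zero_le_one
  refine ⟨hle, ?_⟩
  by_cases hbig : 1 / 2 ≤ N * μ.real {y | c < |y|}
  · have h2 := mul_measureReal_le_sum hμ N hle
    have h3 : (iidLaw ℕ μ).real {x | c < |∑ i ∈ Finset.range N, x i|} ≤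
        (iidLaw ℕ μ).real {x | c / 3 ≤ |∑ i ∈ Finset.range N, x i|} :=
      measureReal_mono (fun x hx => by
        have : c < |∑ i ∈ Finset.range N, x i| := hx
        change c / 3 ≤ |∑ i ∈ Finset.range N, x i|
        linarith) (measure_ne_top _ _)
    linarith
  · set f : ℝ → ℝ := fun y => if |y| ≤ c then y else 0 with hf
    have hfm : Measurable f :=
      Measurable.ite (measurableSet_le (by fun_prop) measurable_const) measurable_id
        measurable_const
    have hodd : ∀ y, f (-y) = -f y := fun y => by
      simp only [hf, abs_neg]; split_ifs <;> simp
    have hfc : ∀ y, |f y| ≤ c := fun y => by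
      simp only [hf]; split_ifs with h
      · exact h
      · simpa using hc.le
    have hv : c ^ 2 ≤ 2 * (N * ∫ y, f y ^ 2 ∂μ) := by
      have hif : Integrable (fun y => f y ^ 2) μ :=
        integrable_of_abs_le (hfm.pow_const 2) (B := c ^ 2) fun y => by
          rw [abs_pow]; exact pow_le_pow_left₀ (abs_nonneg _) (hfc y) 2
      have : ∫ y, min (y ^ 2 / c ^ 2) 1 ∂μ ≤
          (c ^ 2)⁻¹ * ∫ y, f y ^ 2 ∂μ + μ.real {y | c < |y|} := by
        rw [← hI1', ← integral_const_mul, ← integral_add (hif.const_mul _) hI1]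
        refine integral_mono (integrable_min_sq_div c) ((hif.const_mul _).fun_add hI1) fun y => ?_
        by_cases hy : c < |y|
        · simp only [Set.indicator_of_mem (show y ∈ {y : ℝ | c < |y|} from hy)]
          have : 0 ≤ (c ^ 2)⁻¹ * f y ^ 2 := by positivity
          linarith [min_le_right (y ^ 2 / c ^ 2) 1]
        · simp only [Set.indicator_of_notMem (show y ∉ {y : ℝ | c < |y|} from hy),
            hf, if_pos (not_lt.1 hy), add_zero]
          exact (min_le_left _ _).trans_eq (by rw [div_eq_inv_mul])
      have h2 := mul_le_mul_of_nonneg_left this N.cast_nonneg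
      rw [h1] at h2
      have h3 : 1 / 2 ≤ (c ^ 2)⁻¹ * (N * ∫ y, f y ^ 2 ∂μ) := by
        have := not_le.1 hbig
        linarith
      rw [le_inv_mul_iff₀ (pow_pos hc 2)] at h3
      linarith
    have hpz := one_tenth_le_measureReal hμ hfm hodd hfc N
      (by have := pow_pos hc 2; linarith) hv
    have hSm : MeasurableSet {x : ℕ → ℝ | c / 3 ≤ |∑ i ∈ Finset.range N, x i|} :=
      measurableSet_le measurable_const (measurable_sum_range N).abs
    have hT := measurePreserving_reindex (μ := μ) (σ := fun i : ℕ => i) (fun _ _ h => h)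
      (T := fun _ y => if |y| ≤ c then y else -y) fun _ => measurePreserving_neg_off hμ c
    -- The sum and its reflection add up to twice the truncated sum. The latter exceeds `c / 3` in
    -- absolute value, since its square exceeds a quarter of a variance that is at least `c ^ 2 /
    -- 2`.
    have hfin := measureReal_le_two_mul_of_subset hT hSm (A := {x | (N * ∫ y, f y ^ 2 ∂μ) / 4 <
      (∑ i ∈ Finset.range N, f (x i)) ^ 2}) fun x hx => by
        have e : ∑ i ∈ Finset.range N, (if |x i| ≤ c then x i else -x i) =
            2 * ∑ i ∈ Finset.range N, f (x i) - ∑ i ∈ Finset.range N, x i := by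
          rw [Finset.mul_sum, ← Finset.sum_sub_distrib]
          refine Finset.sum_congr rfl fun i _ => ?_
          simp only [hf]
          split_ifs <;> ring
        have hx' : (N * ∫ y, f y ^ 2 ∂μ) / 4 < (∑ i ∈ Finset.range N, f (x i)) ^ 2 := hx
        have hA : c / 3 ≤ |∑ i ∈ Finset.range N, f (x i)| := by
          refine (Real.lt_sqrt_of_sq_lt ?_).le.trans_eq (Real.sqrt_sq_eq_abs _)
          nlinarith [pow_pos hc 2]
        by_contra hcon
        simp only [Set.mem_union, Set.mem_preimage, Set.mem_ofPred_eq, e, not_or, not_le] at hcon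
        have h3 := abs_add_le (∑ i ∈ Finset.range N, x i)
          (2 * ∑ i ∈ Finset.range N, f (x i) - ∑ i ∈ Finset.range N, x i)
        rw [add_sub_cancel, abs_mul, abs_two] at h3
        linarith [hcon.1, hcon.2]
    linarith

end Rows

/-! ### Tail comparison for products of independent variables. -/

section ProductComparison

variable {α μ : Measure ℝ} [IsProbabilityMeasure α] [IsProbabilityMeasure μ]

theorem iidLaw_succ_apply (n : ℕ) {s : Set (ℝ × (Fin n → ℝ))} (hs : MeasurableSet s) :
    iidLaw (Fin (n + 1)) μ {x | (x 0, fun r : Fin n => x r.succ) ∈ s} =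
      (μ.prod (iidLaw (Fin n) μ)) s := by
  have h := measurePreserving_piFinSuccAbove (fun _ : Fin (n + 1) => μ) 0
  have h2 := h.measure_preimage hs.nullMeasurableSet
  rw [iidLaw, iidLaw, Measure.infinitePi_eq_pi, Measure.infinitePi_eq_pi, ← h2]
  rfl

theorem measurable_prod_abs (n : ℕ) : Measurable fun x : Fin n → ℝ => ∏ r, |x r| :=
  Finset.measurable_fun_prod _ fun r _ => (measurable_pi_apply r).abs

/-- Fubini replaces `μ` by `α` one coordinate at a time: with the other coordinates fixed, the
product condition is a tail condition on one variable. -/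
theorem pow_mul_iidLaw_le {K : ENNReal} {c : ℝ}
    (h : ∀ t, c ≤ t → K * μ {y | t < |y|} ≤ α {y | t < |y|}) (n : ℕ) :
    ∀ t : ℝ, 0 ≤ t → K ^ n * iidLaw (Fin n) μ {x | t < ∏ r, |x r| ∧ ∀ r, c < |x r|} ≤
      iidLaw (Fin n) α {x | t < ∏ r, |x r|} := by
  induction n with
  | zero =>
    intro t _
    by_cases h1 : t < 1 <;> simp [h1]
  | succ n ih =>
    intro t ht
    have hm1 : MeasurableSet {x : Fin n → ℝ | ∀ r, c < |x r|} := by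
      simp only [Set.ofPred_forall]
      exact MeasurableSet.iInter fun r => measurableSet_lt measurable_const (by fun_prop)
    have hpm : Measurable fun p : ℝ × (Fin n → ℝ) => |p.1| * ∏ r, |p.2 r| :=
      measurable_fst.abs.mul ((measurable_prod_abs n).comp measurable_snd)
    have hmt : MeasurableSet {p : ℝ × (Fin n → ℝ) | t < |p.1| * ∏ r, |p.2 r|} :=
      measurableSet_lt measurable_const hpm
    have hmc : MeasurableSet {p : ℝ × (Fin n → ℝ) | c < |p.1|} :=
      measurableSet_lt measurable_const measurable_fst.abs
    have e1 := iidLaw_succ_apply (μ := μ) n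
      ((hmt.inter hmc).inter (measurable_snd hm1))
    have e2 := iidLaw_succ_apply (μ := α) n hmt
    have s1 : {x : Fin (n + 1) → ℝ | t < ∏ r, |x r| ∧ ∀ r, c < |x r|} =
        {x | (x 0, fun r : Fin n => x r.succ) ∈ {p : ℝ × (Fin n → ℝ) | t < |p.1| * ∏ r, |p.2 r|} ∩
          {p | c < |p.1|} ∩ Prod.snd ⁻¹' {x | ∀ r, c < |x r|}} := by
      ext x
      simp only [Fin.prod_univ_succ, Fin.forall_fin_succ, Set.mem_ofPred_eq, Set.mem_inter_iff,
        Set.mem_preimage, and_assoc]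
    have s2 : {x : Fin (n + 1) → ℝ | t < ∏ r, |x r|} =
        {x | (x 0, fun r : Fin n => x r.succ) ∈
          {p : ℝ × (Fin n → ℝ) | t < |p.1| * ∏ r, |p.2 r|}} := by
      ext x
      simp only [Fin.prod_univ_succ, Set.mem_ofPred_eq]
    rw [s1, s2, e1, e2, Measure.prod_apply ((hmt.inter hmc).inter (measurable_snd hm1)), pow_succ',
      mul_assoc, ← lintegral_const_mul _ (measurable_measure_prodMk_left
        ((hmt.inter hmc).inter (measurable_snd hm1)))]
    have step1 : ∀ y : ℝ, K ^ n * iidLaw (Fin n) μ (Prod.mk y ⁻¹'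
        ({p : ℝ × (Fin n → ℝ) | t < |p.1| * ∏ r, |p.2 r|} ∩ {p | c < |p.1|} ∩
          Prod.snd ⁻¹' {x | ∀ r, c < |x r|})) ≤ iidLaw (Fin n) α (Prod.mk y ⁻¹'
        ({p : ℝ × (Fin n → ℝ) | t < |p.1| * ∏ r, |p.2 r|} ∩ {p | c < |p.1|})) := by
      intro y
      by_cases hy : c < |y| ∧ y ≠ 0
      · have hy0 : 0 < |y| := abs_pos.2 hy.2
        have := ih (t / |y|) (by positivity)
        have e3 : ∀ p : ℝ, t < |y| * p ↔ t / |y| < p := fun p => by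
          rw [div_lt_iff₀ hy0, mul_comm]
        simpa only [Set.preimage, Set.mem_inter_iff, Set.mem_ofPred_eq, e3, hy.1, and_true]
          using this
      · have : (Prod.mk y ⁻¹' ({p : ℝ × (Fin n → ℝ) | t < |p.1| * ∏ r, |p.2 r|} ∩ {p | c < |p.1|} ∩
          Prod.snd ⁻¹' {x | ∀ r, c < |x r|})) = ∅ := by
          ext z
          simp only [Set.mem_preimage, Set.mem_inter_iff, Set.mem_ofPred_eq,
            Set.mem_empty_iff_false, iff_false]
          rintro ⟨⟨h1, h2⟩, -⟩
          have h0 : y = 0 := by by_contra h0; exact hy ⟨h2, h0⟩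
          rw [h0, abs_zero, zero_mul] at h1
          linarith
        rw [this]
        simp
    have step2 : ∀ z : Fin n → ℝ, K * μ ((fun y => (y, z)) ⁻¹'
        ({p : ℝ × (Fin n → ℝ) | t < |p.1| * ∏ r, |p.2 r|} ∩ {p | c < |p.1|})) ≤
        α ((fun y => (y, z)) ⁻¹' {p : ℝ × (Fin n → ℝ) | t < |p.1| * ∏ r, |p.2 r|}) := by
      intro z
      have hp0 : 0 ≤ ∏ r, |z r| := Finset.prod_nonneg fun r _ => abs_nonneg _
      rcases hp0.eq_or_lt with hp | hp
      · have : (fun y => (y, z)) ⁻¹' ({p : ℝ × (Fin n → ℝ) | t < |p.1| * ∏ r, |p.2 r|} ∩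
            {p | c < |p.1|}) = ∅ := by
          ext y
          simp only [Set.mem_preimage, Set.mem_inter_iff, Set.mem_ofPred_eq, ← hp, mul_zero,
            Set.mem_empty_iff_false, iff_false, not_and]
          intro h0
          linarith
        rw [this]
        simp
      · have e3 : ∀ y : ℝ, t < |y| * ∏ r, |z r| ↔ t / ∏ r, |z r| < |y| := fun y => by
          rw [div_lt_iff₀ hp]
        -- The tail comparison is available only from `c` upwards; the constraint `c < |y|` makes
        -- the raised threshold harmless.
        have := h (max c (t / ∏ r, |z r|)) (le_max_left _ _)
        refine le_trans (le_of_eq ?_) (this.trans (measure_mono fun y hy => ?_))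
        · congr 2
          ext y
          simp only [Set.mem_preimage, Set.mem_inter_iff, Set.mem_ofPred_eq, e3, max_lt_iff]
          exact and_comm
        · exact (e3 y).2 ((le_max_right _ _).trans_lt hy)
    calc K * ∫⁻ y, K ^ n * iidLaw (Fin n) μ (Prod.mk y ⁻¹'
          ({p : ℝ × (Fin n → ℝ) | t < |p.1| * ∏ r, |p.2 r|} ∩ {p | c < |p.1|} ∩
          Prod.snd ⁻¹' {x | ∀ r, c < |x r|})) ∂μ
        ≤ K * ∫⁻ y, iidLaw (Fin n) α (Prod.mk y ⁻¹'
          ({p : ℝ × (Fin n → ℝ) | t < |p.1| * ∏ r, |p.2 r|} ∩ {p | c < |p.1|})) ∂μ :=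
          mul_le_mul_right (lintegral_mono step1) K
      _ = K * ∫⁻ z, μ ((fun y => (y, z)) ⁻¹'
          ({p : ℝ × (Fin n → ℝ) | t < |p.1| * ∏ r, |p.2 r|} ∩ {p | c < |p.1|}))
            ∂(iidLaw (Fin n) α) := by
          rw [← Measure.prod_apply (hmt.inter hmc), Measure.prod_apply_symm (hmt.inter hmc)]
      _ = ∫⁻ z, K * μ ((fun y => (y, z)) ⁻¹'
          ({p : ℝ × (Fin n → ℝ) | t < |p.1| * ∏ r, |p.2 r|} ∩ {p | c < |p.1|}))
            ∂(iidLaw (Fin n) α) :=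
          (lintegral_const_mul _ (measurable_measure_prodMk_right (hmt.inter hmc))).symm
      _ ≤ ∫⁻ z, α ((fun y => (y, z)) ⁻¹' {p : ℝ × (Fin n → ℝ) | t < |p.1| * ∏ r, |p.2 r|})
            ∂(iidLaw (Fin n) α) := lintegral_mono step2
      _ = _ := (Measure.prod_apply_symm hmt).symm

/-- Each adjoined independent factor is at least `s` in absolute value with probability at least
`κ`. -/
theorem pow_mul_iidLaw_add_le {κ : ENNReal} {s : ℝ} (hs : 0 < s) (h : κ ≤ α {y | s ≤ |y|})
    (l m : ℕ) {t : ℝ} (ht : 0 ≤ t) : κ ^ m * iidLaw (Fin l) α {x | t < ∏ r, |x r|} ≤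
      iidLaw (Fin (l + m)) α {x | t * s ^ m < ∏ r, |x r|} := by
  induction m with
  | zero => simp
  | succ m ih =>
    have hpm : Measurable fun p : ℝ × (Fin (l + m) → ℝ) => |p.1| * ∏ r, |p.2 r| :=
      measurable_fst.abs.mul ((measurable_prod_abs _).comp measurable_snd)
    have hmt : MeasurableSet {p : ℝ × (Fin (l + m) → ℝ) | t * s ^ (m + 1) < |p.1| * ∏ r, |p.2 r|} :=
      measurableSet_lt measurable_const hpm
    have e := iidLaw_succ_apply (μ := α) (l + m) hmt
    have s2 : {x : Fin (l + (m + 1)) → ℝ | t * s ^ (m + 1) < ∏ r, |x r|} =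
        {x | (x 0, fun r : Fin (l + m) => x r.succ) ∈
          {p : ℝ × (Fin (l + m) → ℝ) | t * s ^ (m + 1) < |p.1| * ∏ r, |p.2 r|}} := by
      ext x
      change t * s ^ (m + 1) < ∏ r : Fin (l + m + 1), |x r| ↔ _
      simp only [Fin.prod_univ_succ, Set.mem_ofPred_eq]
    rw [s2]
    refine le_trans ?_ e.ge
    calc κ ^ (m + 1) * iidLaw (Fin l) α {x | t < ∏ r, |x r|}
        = κ * (κ ^ m * iidLaw (Fin l) α {x | t < ∏ r, |x r|}) := by rw [pow_succ', mul_assoc]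
      _ ≤ α {y | s ≤ |y|} * iidLaw (Fin (l + m)) α {x | t * s ^ m < ∏ r, |x r|} :=
          mul_le_mul' h ih
      _ = (α.prod (iidLaw (Fin (l + m)) α))
            ({y | s ≤ |y|} ×ˢ {x | t * s ^ m < ∏ r, |x r|}) := (Measure.prod_prod _ _).symm
      _ ≤ _ := measure_mono fun p hp => by
          have h1 : s ≤ |p.1| := hp.1
          have h2 : t * s ^ m < ∏ r, |p.2 r| := hp.2
          change t * s ^ (m + 1) < |p.1| * ∏ r, |p.2 r|
          have h0 : 0 ≤ t * s ^ m := by positivity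
          calc t * s ^ (m + 1) = s * (t * s ^ m) := by ring
            _ < s * ∏ r, |p.2 r| := mul_lt_mul_of_pos_left h2 hs
            _ ≤ |p.1| * ∏ r, |p.2 r| := mul_le_mul_of_nonneg_right h1 (h0.trans h2.le)

end ProductComparison

/-! ### Polarization by sign changes of disjoint blocks. -/

section Polarization

variable {d : ℕ}

theorem prod_signFlip (F I : Finset ℕ) (x : ℕ → ℝ) :
    ∏ i ∈ I, signFlip F x i = (-1) ^ (I ∩ F).card * ∏ i ∈ I, x i := by
  have : ∀ i ∈ I, signFlip F x i = (if i ∈ F then -1 else 1) * x i := fun i _ => by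
    unfold signFlip; split_ifs <;> ring
  rw [Finset.prod_congr rfl this, Finset.prod_mul_distrib, Finset.prod_ite]
  simp [Finset.filter_mem_eq_inter]

/-- A set of size `d` meeting `d` disjoint blocks picks exactly one index from each, which is the
expansion of the product of block sums. -/
theorem sum_transversal_prod {n : ℕ} {B : Fin d → Finset ℕ}
    (hB : ∀ j, B j ⊆ Finset.range n) (hdisj : ∀ j j', j ≠ j' → Disjoint (B j) (B j'))
    (x : ℕ → ℝ) :
    ∑ I ∈ (Finset.range n).powersetCard d with ∀ j, (I ∩ B j).Nonempty, ∏ i ∈ I, x i =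
      ∏ j, ∑ i ∈ B j, x i := by
  classical
  rw [Finset.prod_univ_sum]
  have huniq : ∀ {j j' : Fin d} {i : ℕ}, i ∈ B j → i ∈ B j' → j = j' := fun {j j' i} h h' => by
    by_contra hne
    exact Finset.disjoint_left.1 (hdisj j j' hne) h h'
  have hinj : ∀ f ∈ Fintype.piFinset B, Function.Injective f := fun f hf j j' h =>
    huniq (Fintype.mem_piFinset.1 hf j) (h ▸ Fintype.mem_piFinset.1 hf j')
  symm
  refine Finset.sum_bij (fun f _ => Finset.univ.image f) (fun f hf => ?_)
    (fun f hf f' hf' h => ?_) (fun I hI => ?_) fun f hf => ?_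
  · have hfB := Fintype.mem_piFinset.1 hf
    refine Finset.mem_filter.2 ⟨Finset.mem_powersetCard.2 ⟨fun i hi => ?_, ?_⟩, fun j =>
      ⟨f j, Finset.mem_inter.2 ⟨Finset.mem_image_of_mem _ (Finset.mem_univ j), hfB j⟩⟩⟩
    · obtain ⟨j, -, rfl⟩ := Finset.mem_image.1 hi
      exact hB j (hfB j)
    · rw [Finset.card_image_of_injective _ (hinj f hf)]; simp
  · ext j
    have h1 : f j ∈ Finset.univ.image f' := by
      rw [← h]; exact Finset.mem_image_of_mem _ (Finset.mem_univ j)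
    obtain ⟨j', -, hj'⟩ := Finset.mem_image.1 h1
    have := huniq (Fintype.mem_piFinset.1 hf j) (hj' ▸ Fintype.mem_piFinset.1 hf' j')
    rw [← hj', this]
  · obtain ⟨hI1, hI2⟩ := Finset.mem_filter.1 hI
    choose f hf using hI2
    have hfB : f ∈ Fintype.piFinset B :=
      Fintype.mem_piFinset.2 fun j => (Finset.mem_inter.1 (hf j)).2
    refine ⟨f, hfB, Finset.eq_of_subset_of_card_le (fun i hi => ?_) ?_⟩
    · obtain ⟨j, -, rfl⟩ := Finset.mem_image.1 hi
      exact (Finset.mem_inter.1 (hf j)).1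
    · rw [Finset.card_image_of_injective _ (hinj f hfB), (Finset.mem_powersetCard.1 hI1).2]; simp
  · rw [Finset.prod_image fun j _ j' _ h => hinj f hf h]

/-- Alternating over sign changes of `d` disjoint blocks turns the elementary symmetric
polynomial of degree `d` into the product of the block sums. -/
theorem sum_neg_one_pow_mul_kernelSum {n : ℕ} {B : Fin d → Finset ℕ}
    (hB : ∀ j, B j ⊆ Finset.range n) (hdisj : ∀ j j', j ≠ j' → Disjoint (B j) (B j'))
    (x : ℕ → ℝ) :
    ∑ E : Finset (Fin d), (-1 : ℝ) ^ E.card *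
        kernelSum (fun I x => ∏ i ∈ I, x i) d n (signFlip (E.biUnion B) x) =
      2 ^ d * ∏ j, ∑ i ∈ B j, x i := by
  classical
  have hcard : ∀ (I : Finset ℕ) (E : Finset (Fin d)),
      (I ∩ E.biUnion B).card = ∑ j ∈ E, (I ∩ B j).card := fun I E => by
    rw [Finset.inter_biUnion, Finset.card_biUnion]
    intro j _ j' _ hjj
    exact (hdisj j j' hjj).mono Finset.inter_subset_right Finset.inter_subset_right
  -- A missed block gives a factor `1 - 1 = 0`; if no block is missed, each is met exactly once and
  -- gives a factor `2`.
  have hI : ∀ I ∈ (Finset.range n).powersetCard d,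
      ∏ j : Fin d, (1 + -(-1 : ℝ) ^ (I ∩ B j).card) =
        if ∀ j, (I ∩ B j).Nonempty then 2 ^ d else 0 := fun I hI => by
    split_ifs with h
    · have hle : ∀ j, 1 ≤ (I ∩ B j).card := fun j => Finset.card_pos.2 (h j)
      have hsum : ∑ j : Fin d, (I ∩ B j).card ≤ ∑ j : Fin d, 1 := by
        rw [← hcard I Finset.univ]
        refine (Finset.card_le_card Finset.inter_subset_left).trans ?_
        rw [(Finset.mem_powersetCard.1 hI).2]; simp
      have heq : ∀ j ∈ Finset.univ, 1 = (I ∩ B j).card :=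
        (Finset.sum_eq_sum_iff_of_le fun j _ => hle j).1
          (le_antisymm (Finset.sum_le_sum fun j _ => hle j) hsum)
      rw [Finset.prod_congr rfl fun j hj => by rw [← heq j hj]]
      norm_num
    · push Not at h
      obtain ⟨j, hj⟩ := h
      exact Finset.prod_eq_zero (Finset.mem_univ j) (by rw [hj]; simp)
  calc ∑ E : Finset (Fin d), (-1 : ℝ) ^ E.card *
        kernelSum (fun I x => ∏ i ∈ I, x i) d n (signFlip (E.biUnion B) x)
      = ∑ E : Finset (Fin d), ∑ I ∈ (Finset.range n).powersetCard d,
          (∏ j ∈ E, -(-1 : ℝ) ^ (I ∩ B j).card) * ∏ i ∈ I, x i := by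
        refine Finset.sum_congr rfl fun E _ => ?_
        simp only [kernelSum, Finset.mul_sum]
        refine Finset.sum_congr rfl fun I _ => ?_
        rw [prod_signFlip, hcard, ← mul_assoc, Finset.prod_neg, Finset.prod_pow_eq_pow_sum]
    _ = ∑ I ∈ (Finset.range n).powersetCard d,
          (∏ j : Fin d, (1 + -(-1 : ℝ) ^ (I ∩ B j).card)) * ∏ i ∈ I, x i := by
        rw [Finset.sum_comm]
        refine Finset.sum_congr rfl fun I _ => ?_
        rw [← Finset.sum_mul, Finset.prod_one_add, Finset.powerset_univ]
    _ = ∑ I ∈ (Finset.range n).powersetCard d,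
          if ∀ j, (I ∩ B j).Nonempty then 2 ^ d * ∏ i ∈ I, x i else 0 := by
        refine Finset.sum_congr rfl fun I hI' => ?_
        rw [hI I hI']
        split_ifs <;> simp
    _ = _ := by
        rw [← Finset.sum_filter, ← Finset.mul_sum, sum_transversal_prod hB hdisj]

/-- The product of block sums is a signed average of `2 ^ d` flipped kernel sums, so one of these is
at least as large. -/
theorem exists_lt_abs_kernelSum {n : ℕ} {B : Fin d → Finset ℕ}
    (hB : ∀ j, B j ⊆ Finset.range n) (hdisj : ∀ j j', j ≠ j' → Disjoint (B j) (B j'))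
    {x : ℕ → ℝ} {t : ℝ} (ht : t < ∏ j, |∑ i ∈ B j, x i|) :
    ∃ E : Finset (Fin d),
      t < |kernelSum (fun I x => ∏ i ∈ I, x i) d n (signFlip (E.biUnion B) x)| := by
  by_contra hcon
  push Not at hcon
  have h1 := congrArg abs (sum_neg_one_pow_mul_kernelSum hB hdisj x)
  rw [abs_mul, Finset.abs_prod, abs_of_pos (by positivity : (0 : ℝ) < 2 ^ d)] at h1
  have h2 : |∑ E : Finset (Fin d), (-1 : ℝ) ^ E.card *
      kernelSum (fun I x => ∏ i ∈ I, x i) d n (signFlip (E.biUnion B) x)| ≤ 2 ^ d * t := by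
    refine (Finset.abs_sum_le_sum_abs _ _).trans ?_
    have := Finset.sum_le_card_nsmul (Finset.univ : Finset (Finset (Fin d))) (fun E =>
      |(-1 : ℝ) ^ E.card * kernelSum (fun I x => ∏ i ∈ I, x i) d n (signFlip (E.biUnion B) x)|) t
      fun E _ => by rw [abs_mul, abs_pow, abs_neg, abs_one, one_pow, one_mul]; exact hcon E
    refine this.trans_eq ?_
    simp
  rw [h1] at h2
  exact absurd (le_of_mul_le_mul_left h2 (by positivity)) (not_le.2 ht)

variable {μ : Measure ℝ} [IsProbabilityMeasure μ]

theorem measurable_kernelSum_prod (d n : ℕ) :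
    Measurable (kernelSum (fun I x => ∏ i ∈ I, x i) d n) :=
  Finset.measurable_fun_sum _ fun _ _ =>
    Finset.measurable_fun_prod _ fun i _ => measurable_pi_apply i

theorem dependsOn_kernelSum_prod (d n : ℕ) :
    DependsOn (kernelSum (fun I x => ∏ i ∈ I, x i) d n) (Finset.range n : Set ℕ) :=
  fun _ _ h => Finset.sum_congr rfl fun _ hI => Finset.prod_congr rfl fun i hi =>
    h i ((Finset.mem_powersetCard.1 hI).1 hi)

/-- The blocks lie beyond the past `range m`, so `F` is independent of the block sums and invariant
under the `2 ^ d` flips; a union bound over the flips costs the factor `2 ^ d`. -/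
theorem measureReal_mul_le_inter (hμ : MeasurePreserving (fun x : ℝ => -x) μ μ) {m n : ℕ}
    {B : Fin d → Finset ℕ} (hB : ∀ j, B j ⊆ Finset.Ico m n)
    (hdisj : ∀ j j', j ≠ j' → Disjoint (B j) (B j')) {F : Set (ℕ → ℝ)} (hF : MeasurableSet F)
    (hFm : DependsOn (· ∈ F) (Finset.range m : Set ℕ)) (t : ℝ) :
    (iidLaw ℕ μ).real F * (iidLaw ℕ μ).real {x | t < ∏ j, |∑ i ∈ B j, x i|} ≤
      2 ^ d * (iidLaw ℕ μ).real
        (F ∩ {x | t < |kernelSum (fun I x => ∏ i ∈ I, x i) d n x|}) := by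
  classical
  set A : Set (ℕ → ℝ) := {x | t < |kernelSum (fun I x => ∏ i ∈ I, x i) d n x|}
  set S : Set (ℕ → ℝ) := {x | t < ∏ j, |∑ i ∈ B j, x i|}
  have hA : MeasurableSet A :=
    measurableSet_lt measurable_const (measurable_kernelSum_prod d n).abs
  have hSm : MeasurableSet S := by
    refine measurableSet_lt measurable_const (Finset.measurable_fun_prod _ fun j _ => ?_)
    exact (Finset.measurable_fun_sum _ fun i _ => measurable_pi_apply i).abs
  have hBr : ∀ j, B j ⊆ Finset.range n := fun j i hi =>
    Finset.mem_range.2 (Finset.mem_Ico.1 (hB j hi)).2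
  have hind : (iidLaw ℕ μ).real (F ∩ S) = (iidLaw ℕ μ).real F * (iidLaw ℕ μ).real S := by
    rw [Measure.real, measure_inter_of_dependsOn hF hSm (s := Finset.range m)
      (t := Finset.Ico m n) ?_ hFm ?_, ENNReal.toReal_mul]
    · rfl
    · rw [Finset.disjoint_left]
      intro i hi hi'
      rw [Finset.mem_range] at hi
      rw [Finset.mem_Ico] at hi'
      omega
    · intro x y h
      have : ∀ j, ∑ i ∈ B j, x i = ∑ i ∈ B j, y i := fun j =>
        Finset.sum_congr rfl fun i hi => h i (hB j hi)
      simp only [S, Set.mem_ofPred_eq, this]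
  rw [← hind]
  have hFflip : ∀ (E : Finset (Fin d)) x, signFlip (E.biUnion B) x ∈ F ↔ x ∈ F := fun E x => by
    have : (signFlip (E.biUnion B) x ∈ F) = (x ∈ F) := hFm fun i hi => by
      have : i ∉ E.biUnion B := fun hmem => by
        obtain ⟨j, -, hj⟩ := Finset.mem_biUnion.1 hmem
        have h1 := (Finset.mem_Ico.1 (hB j hj)).1
        have h2 := Finset.mem_range.1 (Finset.mem_coe.1 hi)
        omega
      simp [signFlip, this]
    rw [this]
  have hsub : F ∩ S ⊆ ⋃ E ∈ (Finset.univ : Finset (Finset (Fin d))),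
      signFlip (E.biUnion B) ⁻¹' (F ∩ A) := fun x hx => by
    obtain ⟨E, hE⟩ := exists_lt_abs_kernelSum hBr hdisj hx.2
    exact Set.mem_iUnion₂.2 ⟨E, Finset.mem_univ E, (hFflip E x).2 hx.1, hE⟩
  refine (measureReal_mono hsub (measure_ne_top _ _)).trans
    ((measureReal_biUnion_finset_le _ _).trans_eq ?_)
  rw [Finset.sum_congr rfl fun E _ => (measurePreserving_signFlip hμ _).measureReal_preimage
    (hF.inter hA).nullMeasurableSet]
  simp

/-- Sums over disjoint blocks of length `N` are independent copies of the sum of `N` terms. -/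
theorem iidLaw_prod_blockSum (m N : ℕ) (t : ℝ) :
    iidLaw ℕ μ {x | t < ∏ j : Fin d,
        |∑ i ∈ Finset.Ico (m + j * N) (m + (j + 1) * N), x i|} =
      iidLaw (Fin d) ((iidLaw ℕ μ).map fun x => ∑ i ∈ Finset.range N, x i)
        {y | t < ∏ j, |y j|} := by
  -- Division with remainder by `N` recovers the block and the position within it.
  have hσ : Function.Injective fun p : Fin d × Fin N => m + (p.1 : ℕ) * N + (p.2 : ℕ) := by
    rintro ⟨j, i⟩ ⟨j', i'⟩ h
    have h' : (i : ℕ) + N * (j : ℕ) = i' + N * j' := by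
      dsimp only at h; rw [mul_comm N, mul_comm N]; omega
    have hN : 0 < N := i.pos
    have h1 : (j : ℕ) = j' := by
      have := congrArg (· / N) h'
      simpa [Nat.add_mul_div_left _ _ hN, Nat.div_eq_of_lt i.2, Nat.div_eq_of_lt i'.2] using this
    have h2 : (i : ℕ) = i' := by rw [h1] at h'; omega
    exact Prod.ext (Fin.ext h1) (Fin.ext h2)
  have hp := measurePreserving_comp_injective (μ := μ) hσ
  have hcurry := Measure.infinitePi_map_curry (fun (_ : Fin d) (_ : Fin N) => μ)
  have hsum : Measurable fun z : Fin N → ℝ => ∑ i, z i := by fun_prop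
  have hmap := Measure.infinitePi_map_pi (fun _ : Fin d => iidLaw (Fin N) μ)
    (f := fun _ z => ∑ i, z i) fun _ => hsum
  have hrow : (iidLaw (Fin N) μ).map (fun z => ∑ i, z i) =
      (iidLaw ℕ μ).map fun x => ∑ i ∈ Finset.range N, x i := by
    rw [← (measurePreserving_comp_injective (μ := μ) (Fin.val_injective (n := N))).map_eq,
      Measure.map_map hsum (by fun_prop)]
    congr 1
    ext x
    exact Fin.sum_univ_eq_sum_range (fun i => x i) N
  have hfun : Measurable fun (w : Fin d → Fin N → ℝ) (j : Fin d) => ∑ i, w j i :=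
    measurable_pi_lambda _ fun j => hsum.comp (measurable_pi_apply j)
  rw [hrow] at hmap
  change _ = iidLaw (Fin d) _ at hmap
  change _ = Measure.infinitePi fun _ : Fin d => iidLaw (Fin N) μ at hcurry
  change Measure.map _ (iidLaw (Fin d × Fin N) μ) = _ at hcurry
  rw [← hmap, ← hcurry, ← hp.map_eq, Measure.map_map (by fun_prop) hp.measurable,
    Measure.map_map hfun (by fun_prop), Measure.map_apply (by fun_prop)
      (measurableSet_lt measurable_const (measurable_prod_abs d))]
  congr 1
  ext x
  simp only [Set.mem_ofPred_eq, Set.mem_preimage, Function.comp_apply]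
  have : ∀ j : Fin d, ∑ i ∈ Finset.Ico (m + (j : ℕ) * N) (m + ((j : ℕ) + 1) * N), x i =
      ∑ i : Fin N, x (m + (j : ℕ) * N + (i : ℕ)) := fun j => by
    rw [Finset.sum_Ico_eq_sum_range, show m + ((j : ℕ) + 1) * N - (m + (j : ℕ) * N) = N by
      rw [Nat.add_mul]; omega, Fin.sum_univ_eq_sum_range (fun i => x (m + (j : ℕ) * N + i)) N]
  simp only [this]
  rfl

end Polarization

/-! ### A conditional Borel–Cantelli lemma. -/

section ConditionalBorelCantelli

/-- If every avoidance event of the past makes `A K` at least `δ K` likely, then `∑ δ K = ∞` forces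
infinitely many `A K` to occur. -/
theorem summable_of_ae_eventually_notMem {Ω : Type*} [MeasurableSpace Ω] {P : Measure Ω}
    [IsProbabilityMeasure P] {A : ℕ → Set Ω} {δ : ℕ → ℝ} (hA : ∀ K, MeasurableSet (A K))
    (hδ : ∀ K, 0 ≤ δ K)
    (h : ∀ m K, m ≤ K → δ K * P.real {x | ∀ i, m ≤ i → i < K → x ∉ A i} ≤
      P.real ({x | ∀ i, m ≤ i → i < K → x ∉ A i} ∩ A K))
    (hae : ∀ᵐ x ∂P, ∀ᶠ K in atTop, x ∉ A K) : Summable δ := by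
  by_contra hns
  -- Each further step multiplies the avoidance probability by at most `1 - δ ≤ exp (-δ)`.
  have hbound : ∀ m j, P.real {x | ∀ i, m ≤ i → i < m + j → x ∉ A i} ≤
      Real.exp (-∑ i ∈ Finset.range j, δ (i + m)) := fun m j => by
    induction j with
    | zero => simp
    | succ j ih =>
      have hsplit := measureReal_inter_add_sdiff (μ := P)
        (s := {x | ∀ i, m ≤ i → i < m + j → x ∉ A i}) (hA (m + j))
      have hset : {x | ∀ i, m ≤ i → i < m + (j + 1) → x ∉ A i} ⊆
          {x | ∀ i, m ≤ i → i < m + j → x ∉ A i} \ A (m + j) := fun x hx =>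
        ⟨fun i hi hij => hx i hi (by omega), hx (m + j) (by omega) (by omega)⟩
      have h1 := measureReal_mono hset (measure_ne_top P _)
      have h2 := h m (m + j) (by omega)
      have h3 : 1 - δ (m + j) ≤ Real.exp (-δ (m + j)) := by
        have := Real.add_one_le_exp (-δ (m + j)); linarith
      rw [Finset.sum_range_succ, neg_add, Real.exp_add, add_comm j m]
      calc P.real {x | ∀ i, m ≤ i → i < m + (j + 1) → x ∉ A i}
          ≤ (1 - δ (m + j)) * P.real {x | ∀ i, m ≤ i → i < m + j → x ∉ A i} := by linarith
        _ ≤ Real.exp (-δ (m + j)) * P.real {x | ∀ i, m ≤ i → i < m + j → x ∉ A i} :=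
            mul_le_mul_of_nonneg_right h3 measureReal_nonneg
        _ ≤ Real.exp (-δ (m + j)) * Real.exp (-∑ i ∈ Finset.range j, δ (i + m)) :=
            mul_le_mul_of_nonneg_left ih (Real.exp_pos _).le
        _ = _ := mul_comm _ _
  have hnull : ∀ m, P {x | ∀ i, m ≤ i → x ∉ A i} = 0 := fun m => by
    have hdiv : Tendsto (fun j => ∑ i ∈ Finset.range j, δ (i + m)) atTop atTop :=
      (not_summable_iff_tendsto_nat_atTop_of_nonneg fun i => hδ _).1
        ((summable_nat_add_iff m).not.2 hns)
    have hlim := Real.tendsto_exp_neg_atTop_nhds_zero.comp hdiv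
    have hle : P.real {x | ∀ i, m ≤ i → x ∉ A i} ≤ 0 :=
      ge_of_tendsto hlim (Eventually.of_forall fun j =>
        (measureReal_mono (show {x | ∀ i, m ≤ i → x ∉ A i} ⊆
            {x | ∀ i, m ≤ i → i < m + j → x ∉ A i} from fun x hx i hi _ => hx i hi)
          (measure_ne_top P _)).trans (hbound m j))
    exact (measureReal_eq_zero_iff (measure_ne_top P _)).1 (le_antisymm hle measureReal_nonneg)
  have hall : ∀ᵐ x ∂P, ∀ m, ¬ ∀ i, m ≤ i → x ∉ A i := ae_all_iff.2 fun m => by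
    rw [ae_iff]; simpa using hnull m
  obtain ⟨x, hx, hx'⟩ := (hae.and hall).exists
  obtain ⟨m, hm⟩ := eventually_atTop.1 hx
  exact hx' m hm

end ConditionalBorelCantelli

/-! ### From almost sure convergence to the series conditions. -/

section Necessity

variable {μ : Measure ℝ} [IsProbabilityMeasure μ] {d : ℕ}

theorem RegularNormalizing.le_pow_mul {γ : ℕ → ℝ} {C : ℝ} (hC0 : 0 ≤ C)
    (hC : ∀ n, 1 ≤ n → γ (2 * n) ≤ C * γ n) (K r : ℕ) :
    γ (2 ^ (K + r)) ≤ C ^ r * γ (2 ^ K) := by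
  induction r with
  | zero => simp
  | succ r ih =>
    rw [← add_assoc, pow_succ', pow_succ', mul_assoc]
    exact (hC _ Nat.one_le_two_pow).trans (mul_le_mul_of_nonneg_left ih hC0)

/-- The avoidance event before `K` depends on coordinates below `2 ^ (K + r)`, and the blocks for
`K` lie in `[2 ^ (K + r), 2 ^ (K + r + 1))`. This is the setting of the conditional Borel–Cantelli
lemma. -/
theorem summable_blockProb (hμ : MeasurePreserving (fun x : ℝ => -x) μ μ) {γ : ℕ → ℝ}
    (hγ : RegularNormalizing d γ)
    (h : ∀ᵐ x ∂(iidLaw ℕ μ), Tendsto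
      (fun n => (γ n)⁻¹ * kernelSum (fun I x => ∏ i ∈ I, x i) d n x) atTop (𝓝 0))
    {ε : ℝ} (hε : 0 < ε) :
    Summable fun K => (iidLaw (Fin d) ((iidLaw ℕ μ).map fun x => ∑ i ∈ Finset.range (2 ^ K), x i)).real
      {y | ε * γ (2 ^ K) < ∏ j, |y j|} := by
  obtain ⟨C, hC1, hC⟩ := hγ.exists_doubling
  have hC0 : 0 < C := by linarith
  -- With `d ≤ 2 ^ r`, `d` blocks of length `2 ^ K` fit in that dyadic interval.
  obtain ⟨r, hr⟩ : ∃ r : ℕ, d ≤ 2 ^ r := ⟨d, Nat.lt_two_pow_self.le⟩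
  -- Compensates the `r + 1` doublings between `γ (2 ^ K)` and `γ (2 ^ (K + r + 1))`.
  set η := ε / C ^ (r + 1)
  have hη : 0 < η := by positivity
  set t : ℕ → ℝ := fun K => η * γ (2 ^ (K + r + 1))
  set A : ℕ → Set (ℕ → ℝ) := fun K =>
    {x | t K < |kernelSum (fun I x => ∏ i ∈ I, x i) d (2 ^ (K + r + 1)) x|}
  set B : ℕ → Fin d → Finset ℕ := fun K j =>
    Finset.Ico (2 ^ (K + r) + (j : ℕ) * 2 ^ K) (2 ^ (K + r) + ((j : ℕ) + 1) * 2 ^ K)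
  have hAm : ∀ K, MeasurableSet (A K) := fun K =>
    measurableSet_lt measurable_const (measurable_kernelSum_prod d _).abs
  have hBsub : ∀ K j, B K j ⊆ Finset.Ico (2 ^ (K + r)) (2 ^ (K + r + 1)) := fun K j => by
    refine Finset.Ico_subset_Ico (Nat.le_add_right _ _) ?_
    have h1 : (j : ℕ) + 1 ≤ 2 ^ r := (Nat.succ_le_of_lt j.2).trans hr
    have h2 : ((j : ℕ) + 1) * 2 ^ K ≤ 2 ^ r * 2 ^ K := Nat.mul_le_mul_right _ h1
    rw [← pow_add, add_comm r K] at h2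
    rw [pow_succ]
    omega
  have hBdisj : ∀ K (j j' : Fin d), j ≠ j' → Disjoint (B K j) (B K j') := fun K j j' hjj => by
    have key : ∀ a b : Fin d, a < b → Disjoint (B K a) (B K b) := fun a b hab => by
      rw [Finset.disjoint_left]
      intro i hi hi'
      have h1 := (Finset.mem_Ico.1 hi).2
      have h2 := (Finset.mem_Ico.1 hi').1
      have h3 : ((a : ℕ) + 1) * 2 ^ K ≤ (b : ℕ) * 2 ^ K :=
        Nat.mul_le_mul_right _ (Nat.succ_le_of_lt hab)
      omega
    rcases lt_or_gt_of_ne hjj with hlt | hlt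
    · exact key j j' hlt
    · exact (key j' j hlt).symm
  set q : ℕ → ℝ := fun K => (iidLaw ℕ μ).real {x | t K < ∏ j, |∑ i ∈ B K j, x i|}
  have hae : ∀ᵐ x ∂(iidLaw ℕ μ), ∀ᶠ K in atTop, x ∉ A K := by
    filter_upwards [h] with x hx
    have hsub : Tendsto (fun K : ℕ => 2 ^ (K + r + 1)) atTop atTop :=
      (tendsto_pow_atTop_atTop_of_one_lt one_lt_two).comp (tendsto_add_atTop_nat (r + 1))
    have hx2 := (hx.comp hsub).abs
    rw [abs_zero] at hx2
    filter_upwards [hx2.eventually (ge_mem_nhds hη)] with K hK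
    have hγK := hγ.pos (2 ^ (K + r + 1)) Nat.one_le_two_pow
    simp only [Function.comp_apply, abs_mul, abs_of_pos (inv_pos.2 hγK)] at hK
    rw [inv_mul_le_iff₀ hγK, mul_comm] at hK
    exact not_lt.2 hK
  have hq : Summable fun K => ((2 : ℝ) ^ d)⁻¹ * q K := by
    refine summable_of_ae_eventually_notMem hAm
      (fun K => mul_nonneg (by positivity) measureReal_nonneg) (fun m K _ => ?_) hae
    have hF : MeasurableSet {x : ℕ → ℝ | ∀ i, m ≤ i → i < K → x ∉ A i} := by
      simp only [Set.ofPred_forall]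
      exact MeasurableSet.iInter fun i => MeasurableSet.iInter fun _ => MeasurableSet.iInter fun _ =>
        (hAm i).compl
    have hFdep : DependsOn (· ∈ {x : ℕ → ℝ | ∀ i, m ≤ i → i < K → x ∉ A i})
        (Finset.range (2 ^ (K + r)) : Set ℕ) := fun x y hxy => by
      simp only [Set.mem_ofPred_eq, eq_iff_iff]
      refine forall_congr' fun i => forall_congr' fun _ => forall_congr' fun hiK => ?_
      have : kernelSum (fun I x => ∏ i ∈ I, x i) d (2 ^ (i + r + 1)) x =
          kernelSum (fun I x => ∏ i ∈ I, x i) d (2 ^ (i + r + 1)) y := by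
        refine dependsOn_kernelSum_prod d _ fun a ha => hxy a ?_
        rw [Finset.mem_coe, Finset.mem_range] at ha ⊢
        exact ha.trans_le (Nat.pow_le_pow_right two_pos (by omega))
      simp only [A, Set.mem_ofPred_eq, this]
    have := measureReal_mul_le_inter hμ (hBsub K) (hBdisj K) hF hFdep (t K)
    rw [mul_assoc, inv_mul_le_iff₀ (by positivity), mul_comm]
    exact this
  have hq' : Summable q := (summable_mul_left_iff (by positivity)).1 hq
  refine Summable.of_nonneg_of_le (fun K => measureReal_nonneg) (fun K => ?_) hq'
  have hαp : IsProbabilityMeasure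
      ((iidLaw ℕ μ).map fun x => ∑ i ∈ Finset.range (2 ^ K), x i) :=
    Measure.isProbabilityMeasure_map (measurable_sum_range _).aemeasurable
  have e := iidLaw_prod_blockSum (μ := μ) (d := d) (2 ^ (K + r)) (2 ^ K) (t K)
  have e2 : q K = (iidLaw (Fin d) ((iidLaw ℕ μ).map
      fun x => ∑ i ∈ Finset.range (2 ^ K), x i)).real {y | t K < ∏ j, |y j|} :=
    congrArg ENNReal.toReal e
  rw [e2]
  have h1 := RegularNormalizing.le_pow_mul hC0.le hC K (r + 1)
  suffices h2 : t K ≤ ε * γ (2 ^ K) from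
    measureReal_mono (fun y hy => h2.trans_lt hy) (measure_ne_top _ _)
  calc t K = η * γ (2 ^ (K + (r + 1))) := rfl
    _ ≤ η * (C ^ (r + 1) * γ (2 ^ K)) := mul_le_mul_of_nonneg_left h1 hη.le
    _ = ε * γ (2 ^ K) := by simp only [η]; field_simp

theorem bigEvent_univ_eq {l m : ℕ} {a c : ℝ} (ha : 0 ≤ a) (hc : 0 < c) :
    bigEvent (a ^ 2) (c ^ 2) m (Finset.univ : Finset (Fin l)) =
      {x | a / c ^ m < ∏ r, |x r| ∧ ∀ r, c < |x r|} := by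
  ext x
  have h1 : a ^ 2 / (c ^ 2) ^ m = (a / c ^ m) ^ 2 := by
    rw [div_pow, ← pow_mul, ← pow_mul, mul_comm]
  have h2 : ∏ r, x r ^ 2 = (∏ r, |x r|) ^ 2 := by
    rw [← Finset.prod_pow]; simp
  have h3 : ∀ r, c ^ 2 < x r ^ 2 ↔ c < |x r| := fun r => by
    rw [sq_lt_sq, abs_of_pos hc]
  simp only [bigEvent, Set.mem_ofPred_eq, h1, h2, Finset.mem_univ, true_imp_iff, h3]
  rw [pow_lt_pow_iff_left₀ (div_nonneg ha (by positivity))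
    (Finset.prod_nonneg fun r _ => abs_nonneg _) two_ne_zero]

/-- Among `d` independent copies of the sum, `l` are compared with single variables above `c`, at
cost `4` each, and the other `d - l` are at least `c / 3` in absolute value, at cost `20` each. The
powers of `c` cancel. -/
theorem pow_mul_bigProb_le (hμ : MeasurePreserving (fun x : ℝ => -x) μ μ) {c a : ℝ}
    (hc : 0 < c) (ha : 0 ≤ a) {N l : ℕ} (hl : l ≤ d)
    (h1 : N * ∫ y, min (y ^ 2 / c ^ 2) 1 ∂μ = 1) :
    (N : ℝ) ^ l * bigProb μ (a ^ 2) (c ^ 2) (d - l) l ≤ 4 ^ l * 20 ^ (d - l) *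
      (iidLaw (Fin d) ((iidLaw ℕ μ).map fun x => ∑ i ∈ Finset.range N, x i)).real
        {y | (1 / 3 : ℝ) ^ d * a < ∏ j, |y j|} := by
  set α := (iidLaw ℕ μ).map fun x => ∑ i ∈ Finset.range N, x i with hα
  have hS := measurable_sum_range N
  have hαp : IsProbabilityMeasure α := Measure.isProbabilityMeasure_map hS.aemeasurable
  obtain ⟨hNc, hκ⟩ := one_twentieth_le_measureReal_sum hμ hc N h1
  have hrow : ∀ t, c ≤ t → ENNReal.ofReal (N / 4) * μ {y | t < |y|} ≤ α {y | t < |y|} := by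
    intro t ht
    have hsub : μ.real {y | t < |y|} ≤ μ.real {y | c < |y|} :=
      measureReal_mono (fun y hy => ht.trans_lt hy) (measure_ne_top _ _)
    have h2 := mul_measureReal_le_sum hμ N (t := t)
      ((mul_le_mul_of_nonneg_left hsub N.cast_nonneg).trans hNc)
    have h3 : α.real {y | t < |y|} =
        (iidLaw ℕ μ).real {x | t < |∑ i ∈ Finset.range N, x i|} := by
      rw [hα, map_measureReal_apply hS (measurableSet_lt measurable_const (by fun_prop))]
      rfl
    rw [← ofReal_measureReal (μ := μ), ← ofReal_measureReal (μ := α),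
      ← ENNReal.ofReal_mul (by positivity), h3]
    exact ENNReal.ofReal_le_ofReal (by linarith)
  have hsmall : ENNReal.ofReal (1 / 20) ≤ α {y | c / 3 ≤ |y|} := by
    have h3 : α.real {y | c / 3 ≤ |y|} =
        (iidLaw ℕ μ).real {x | c / 3 ≤ |∑ i ∈ Finset.range N, x i|} := by
      rw [hα, map_measureReal_apply hS (measurableSet_le measurable_const (by fun_prop))]
      rfl
    rw [← ofReal_measureReal (μ := α), h3]
    exact ENNReal.ofReal_le_ofReal hκ
  have hT : 0 ≤ a / c ^ (d - l) := div_nonneg ha (by positivity)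
  have k1 := pow_mul_iidLaw_le hrow l (a / c ^ (d - l)) hT
  have k2 := pow_mul_iidLaw_add_le (by positivity) hsmall l (d - l) hT
  rw [← bigEvent_univ_eq ha hc] at k1
  have hd : l + (d - l) = d := by omega
  have k3 : iidLaw (Fin (l + (d - l))) α {x | a / c ^ (d - l) * (c / 3) ^ (d - l) < ∏ r, |x r|} ≤
      iidLaw (Fin d) α {y | (1 / 3 : ℝ) ^ d * a < ∏ j, |y j|} := by
    rw [hd]
    have e : a / c ^ (d - l) * (c / 3) ^ (d - l) = (1 / 3 : ℝ) ^ (d - l) * a := by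
      rw [div_pow, div_pow, one_pow]; field_simp
    have e' : (1 / 3 : ℝ) ^ d * a ≤ a / c ^ (d - l) * (c / 3) ^ (d - l) := by
      rw [e]
      exact mul_le_mul_of_nonneg_right
        (pow_le_pow_of_le_one (by norm_num) (by norm_num) (Nat.sub_le _ _)) ha
    exact measure_mono fun y hy => e'.trans_lt hy
  have k4 := (mul_le_mul_right k1 (ENNReal.ofReal (1 / 20) ^ (d - l))).trans (k2.trans k3)
  have k5 := ENNReal.toReal_mono (measure_ne_top _ _) k4
  rw [ENNReal.toReal_mul, ENNReal.toReal_mul, ENNReal.toReal_pow, ENNReal.toReal_pow,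
    ENNReal.toReal_ofReal (by norm_num), ENNReal.toReal_ofReal (by positivity)] at k5
  change (1 / 20 : ℝ) ^ (d - l) * (((N : ℝ) / 4) ^ l * bigProb μ (a ^ 2) (c ^ 2) (d - l) l) ≤
    (iidLaw (Fin d) α).real _ at k5
  calc (N : ℝ) ^ l * bigProb μ (a ^ 2) (c ^ 2) (d - l) l
      = 4 ^ l * 20 ^ (d - l) *
        ((1 / 20 : ℝ) ^ (d - l) * (((N : ℝ) / 4) ^ l * bigProb μ (a ^ 2) (c ^ 2) (d - l) l)) := by
        rw [div_pow, div_pow, one_pow]; field_simp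
    _ ≤ _ := mul_le_mul_of_nonneg_left k5 (by positivity)

theorem summable_of_tendsto_prodSum (hμ : MeasurePreserving (fun x : ℝ => -x) μ μ)
    (hnz : μ.real {0}ᶜ ≠ 0) {γ : ℕ → ℝ} (hγ : RegularNormalizing d γ)
    (h : ∀ᵐ x ∂(iidLaw ℕ μ), Tendsto
      (fun n => (γ n)⁻¹ * kernelSum (fun I x => ∏ i ∈ I, x i) d n x) atTop (𝓝 0))
    {l : ℕ} (hl : l ≤ d) : Summable fun k => (2 : ℝ) ^ (k * l) *
      bigProb μ (γ (2 ^ k) ^ 2) (truncLevel μ id (2 ^ k) ^ 2) (d - l) l := by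
  have hs := (summable_blockProb hμ hγ h (ε := (1 / 3 : ℝ) ^ d) (by positivity)).mul_left
    (4 ^ l * 20 ^ (d - l))
  refine Summable.of_norm_bounded_eventually_nat hs ?_
  filter_upwards [eventually_one_lt_mul_measure hnz] with k hk
  have h0 : 0 ≤ bigProb μ (γ (2 ^ k) ^ 2) (truncLevel μ id (2 ^ k) ^ 2) (d - l) l :=
    measureReal_nonneg
  rw [Real.norm_of_nonneg (mul_nonneg (by positivity) h0)]
  have := pow_mul_bigProb_le (d := d) hμ (truncLevel_pos hk)
    (hγ.pos (2 ^ k) Nat.one_le_two_pow).le hl (truncLevel_eq_one hk)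
  push_cast at this
  rwa [← pow_mul] at this

end Necessity

/-! ### Transfer from the given variables to the sequence space. -/

section Transfer

variable {Ω : Type*} [MeasurableSpace Ω] {P : Measure Ω}

theorem truncLevel_eq_map {Y : Ω → ℝ} (hY : Measurable Y) (n : ℕ) :
    truncLevel P Y n = truncLevel (P.map Y) id n := by
  unfold truncLevel
  congr! 6 with c
  rw [integral_map hY.aemeasurable (by fun_prop)]
  rfl

theorem measurePreserving_iidLaw [IsProbabilityMeasure P] {X : ℕ → Ω → ℝ}
    (hmeas : ∀ i, Measurable (X i)) (hindep : iIndepFun X P)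
    (hident : ∀ i, IdentDistrib (X i) (X 0) P P) :
    MeasurePreserving (fun ω i => X i ω) P (iidLaw ℕ (P.map (X 0))) := by
  refine ⟨measurable_pi_lambda _ hmeas, ?_⟩
  rw [hindep.map_fun_eq_infinitePi_map hmeas]
  exact congrArg _ (funext fun i => (hident i).map_eq)

theorem measureReal_exceedanceEvent [IsProbabilityMeasure P] {X : ℕ → Ω → ℝ}
    (hmeas : ∀ i, Measurable (X i)) (hindep : iIndepFun X P)
    (hident : ∀ i, IdentDistrib (X i) (X 0) P P) (γ : ℕ → ℝ) (d l n : ℕ) :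
    P.real (exceedanceEvent P X γ d l n) = bigProb (P.map (X 0)) (γ n ^ 2)
      (truncLevel (P.map (X 0)) id n ^ 2) (d - l) l := by
  have hμ : IsProbabilityMeasure (P.map (X 0)) :=
    Measure.isProbabilityMeasure_map (hmeas 0).aemeasurable
  have hp := (measurePreserving_comp_injective (μ := P.map (X 0))
    (Fin.val_injective (n := l))).comp (measurePreserving_iidLaw hmeas hindep hident)
  rw [bigProb, ← hp.measureReal_preimage (measurableSet_bigEvent _ _ _ _).nullMeasurableSet,
    ← truncLevel_eq_map (hmeas 0)]
  simp only [exceedanceEvent, bigEvent, ← pow_mul, Set.preimage_ofPred_eq, Finset.mem_univ,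
    true_imp_iff, Function.comp_apply]

theorem ae_tendsto_productSum_iff [IsProbabilityMeasure P] {X : ℕ → Ω → ℝ}
    (hmeas : ∀ i, Measurable (X i)) (hindep : iIndepFun X P)
    (hident : ∀ i, IdentDistrib (X i) (X 0) P P) (γ : ℕ → ℝ) (d : ℕ) :
    (∀ᵐ ω ∂P, Tendsto (fun n : ℕ => (γ n)⁻¹ * productSum d X n ω) atTop (𝓝 0)) ↔
      ∀ᵐ x ∂iidLaw ℕ (P.map (X 0)), Tendsto
        (fun n => (γ n)⁻¹ * kernelSum (fun I x => ∏ i ∈ I, x i) d n x) atTop (𝓝 0) := by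
  have hp := measurePreserving_iidLaw hmeas hindep hident
  rw [← hp.map_eq, ae_map_iff hp.measurable.aemeasurable]
  · simp only [productSum_eq_kernelSum]
  · exact measurableSet_tendsto _ fun n => (measurable_kernelSum_prod d n).const_mul _

end Transfer

theorem theorem1 {Ω : Type*} [MeasurableSpace Ω] (P : Measure Ω) [IsProbabilityMeasure P]
    (d : ℕ) (hd : 1 ≤ d) (X : ℕ → Ω → ℝ) (hmeas : ∀ i, Measurable (X i))
    (hindep : iIndepFun X P) (hident : ∀ i, IdentDistrib (X i) (X 0) P P)
    (hsymm : IdentDistrib (X 0) (fun ω => -X 0 ω) P P)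
    (γ : ℕ → ℝ) (hγ : RegularNormalizing d γ) :
    (∀ᵐ ω ∂P, Tendsto (fun n : ℕ => (γ n)⁻¹ * productSum d X n ω) atTop (𝓝 0)) ↔
      ∀ l : ℕ, 1 ≤ l → l ≤ d →
        Summable (fun k : ℕ =>
          (2 : ℝ) ^ ((k + 1) * l) * P.real (exceedanceEvent P X γ d l (2 ^ (k + 1)))) := by
  have hμp : IsProbabilityMeasure (P.map (X 0)) :=
    Measure.isProbabilityMeasure_map (hmeas 0).aemeasurable
  have hμ : MeasurePreserving (fun x : ℝ => -x) (P.map (X 0)) (P.map (X 0)) := by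
    refine ⟨measurable_neg, ?_⟩
    rw [Measure.map_map measurable_neg (hmeas 0)]
    exact hsymm.map_eq.symm
  -- If `X = 0` almost surely, both sides hold: the product sums vanish, and the exceedance events
  -- are null because they require `X_0 ^ 2` to exceed a square strictly.
  by_cases hnz : (P.map (X 0)).real {0}ᶜ = 0
  · have h0 : ∀ i, ∀ᵐ ω ∂P, X i ω = 0 := fun i => by
      have h1 : ∀ᵐ y ∂P.map (X i), y = 0 := by
        rw [(hident i).map_eq, ae_iff]
        exact (measureReal_eq_zero_iff (measure_ne_top _ _)).1 hnz
      exact ae_of_ae_map (hmeas i).aemeasurable h1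
    refine iff_of_true ?_ fun l hl _ => ?_
    · filter_upwards [ae_all_iff.2 h0] with ω hω
      have hz : ∀ n, productSum d X n ω = 0 := fun n => by
        refine Finset.sum_eq_zero fun i _ => Finset.prod_eq_zero (Finset.mem_univ ⟨0, hd⟩) (hω _)
      simp [hz]
    · have hz : ∀ n, P.real (exceedanceEvent P X γ d l n) = 0 := fun n => by
        rw [measureReal_eq_zero_iff (measure_ne_top _ _)]
        refine measure_mono_null (fun ω hω => ?_) (ae_iff.1 (h0 0))
        have h1 : truncLevel P (X 0) n ^ 2 < X 0 ω ^ 2 := hω.2 ⟨0, hl⟩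
        intro h2
        rw [h2] at h1
        linarith [sq_nonneg (truncLevel P (X 0) n)]
      simp only [hz, mul_zero]
      exact summable_zero
  · simp only [ae_tendsto_productSum_iff hmeas hindep hident,
      measureReal_exceedanceEvent hmeas hindep hident]
    -- The series in (b) starts at `k = 1`; dropping or adding one term does not affect summability.
    have hshift : ∀ l, (Summable fun k => (2 : ℝ) ^ ((k + 1) * l) * bigProb (P.map (X 0))
        (γ (2 ^ (k + 1)) ^ 2) (truncLevel (P.map (X 0)) id (2 ^ (k + 1)) ^ 2) (d - l) l) ↔
        Summable fun k => (2 : ℝ) ^ (k * l) * bigProb (P.map (X 0))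
          (γ (2 ^ k) ^ 2) (truncLevel (P.map (X 0)) id (2 ^ k) ^ 2) (d - l) l := fun l =>
      summable_nat_add_iff (f := fun k => (2 : ℝ) ^ (k * l) * bigProb (P.map (X 0))
        (γ (2 ^ k) ^ 2) (truncLevel (P.map (X 0)) id (2 ^ k) ^ 2) (d - l) l) 1
    simp only [hshift]
    exact ⟨fun h l _ hl => summable_of_tendsto_prodSum hμ hnz hγ h hl,
      tendsto_prodSum_of_summable hd hμ hnz hγ⟩
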